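/- Let $(K,J,g)$ be a compact Kähler manifold with fundamental form $\omega$, and let $\psi$ be a Kähler isometry of $K$, i.e. a holomorphic diffeomorphism $\psi:K\to K$ with $\psi^*g=g$. Let $f=(\psi,\mathrm{Id})$ on $K\times\mathbb S^3$, where $\mathbb S^3\subset\mathbb C^2$ is the unit sphere, and let $M_f$ be the mapping torus of $f$, i.e. the quotient of $K\times\mathbb S^3\times\mathbb R$ by the $\mathbb Z$-action $n\cdot(p,q,t)=(\psi^n(p),q,t+n)$. Let $X=(K\times(\mathbb C^2\setminus\{0\}))/\mathbb Z$ be the quotient by the (free, properly discontinuous, holomorphic) action $n\cdot(p,z)=(\psi^n(p),2^nz)$, with the complex structure induced by the product complex structure. Then $M_f$ is a smooth manifold and admits an SKT (pluriclosed) structure $(I,h)$: there are a complex structure $I$ on $M_f$, compatible with its smooth structure, and a smooth $I$-Hermitian metric $h$ whose fundamental form $\Omega=h(I\cdot,\cdot)$ satisfies $dd^c\Omega=0$, where $d^c\Omega(u,v,w)=-d\Omega(Iu,Iv,Iw)$. More precisely, $I$ and $h$ can be chosen such that $$\Phi:M_f\to X,\qquad \Phi([p,q,t])=[p,2^tq],$$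 is a (well-defined) biholomorphism from $(M_f,I)$ onto $X$, and such that the pull-back of $h$ to $K\times(\mathbb C^2\setminus\{0\})$ under the composition of the projection $K\times(\mathbb C^2\setminus\{0\})\to X$ with $\Phi^{-1}$ is the product metric $g+|z|^{-2}g_E$, where $g_E$ is the Euclidean metric of $\mathbb C^2$. -/

import Mathlib

open scoped Manifold ContDiff Topology

noncomputable section

/-! ### Complex manifolds and the real manifolds underlying them -/

/-- The complex vector space `F`, regarded as a model for real manifolds. A complex manifold is a
space with charts in `F` and complex analytic coordinate changes (`IsManifold 𝓘(ℂ, F) ω M`); its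
underlying real smooth manifold has the same charts, with the model `realModel F`. -/
abbrev realModel (F : Type*) [NormedAddCommGroup F] [NormedSpace ℂ F] : ModelWithCorners ℝ F F :=
  𝓘(ℝ, F)

/-- The real smooth manifold underlying a complex manifold. -/
instance isManifold_realModel {F : Type*} [NormedAddCommGroup F] [NormedSpace ℂ F]
    {M : Type*} [TopologicalSpace M] [ChartedSpace F M] [IsManifold 𝓘(ℂ, F) ω M] :
    IsManifold (realModel F) ∞ M := by
  refine isManifold_of_contDiffOn _ _ _ fun e e' he he' => ?_
  have h := HasGroupoid.compatible (G := contDiffGroupoid ω 𝓘(ℂ, F)) he he'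
  rw [contDiffGroupoid, mem_groupoid_of_pregroupoid] at h
  have h' : ContDiffOn ℂ ω (𝓘(ℂ, F) ∘ e.symm ≫ₕ e' ∘ 𝓘(ℂ, F).symm)
      (𝓘(ℂ, F).symm ⁻¹' (e.symm ≫ₕ e').source ∩ Set.range 𝓘(ℂ, F)) := h.1
  exact (h'.restrict_scalars ℝ).of_le le_top

/-- Multiplication by `i`, as a real linear map. -/
def mulI (F : Type*) [NormedAddCommGroup F] [NormedSpace ℂ F] : F →L[ℝ] F :=
  Complex.I • ContinuousLinearMap.id ℝ F

@[simp] lemma mulI_apply {F : Type*} [NormedAddCommGroup F] [NormedSpace ℂ F] (v : F) :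
    mulI F v = Complex.I • v := rfl

/-- The complex structure `J` of a complex manifold, on the tangent space at `x`. Mathlib identifies
this tangent space with `F` through the preferred chart at `x`, and there `J` is multiplication
by `i`; as coordinate changes are holomorphic, any other chart around `x` gives the same `J`. -/
def complexStructure {F : Type*} [NormedAddCommGroup F] [NormedSpace ℂ F]
    {M : Type*} [TopologicalSpace M] [ChartedSpace F M] (x : M) :
    TangentSpace (realModel F) x →L[ℝ] TangentSpace (realModel F) x :=
  mulI F

/-! ### Hermitian metrics, the Kähler condition and the pluriclosed (SKT) condition -/

/-- The alternating form `(v, w) ↦ B (i v, w)` of a symmetric bilinear form `B` that is invariant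
under multiplication by `i`. -/
def formOfBilin {F : Type*} [NormedAddCommGroup F] [NormedSpace ℂ F] (B : F →L[ℝ] F →L[ℝ] ℝ)
    (hsymm : ∀ v w, B v w = B w v) (hB : ∀ v w, B (mulI F v) (mulI F w) = B v w) :
    F [⋀^Fin 2]→L[ℝ] ℝ where
  toFun v := B (mulI F (v 0)) (v 1)
  map_update_add' := by
    intro _ m i x y
    fin_cases i <;> simp [Function.update]
  map_update_smul' := by
    intro _ m i c x
    fin_cases i <;> simp [Function.update]
  map_eq_zero_of_eq' := by
    intro v i j hij hne
    have h01 : v 0 = v 1 := by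
      fin_cases i <;> fin_cases j <;> simp_all
    have h1 := hB (mulI F (v 1)) (v 1)
    have h2 : mulI F (mulI F (v 1)) = -(v 1) := by
      simp [smul_smul]
    rw [h2, map_neg, neg_apply, hsymm] at h1
    change B (mulI F (v 0)) (v 1) = 0
    rw [h01]
    linarith
  cont := by fun_prop

/-- A smooth Hermitian metric on a complex manifold `M`: a smooth Riemannian metric `g` on the
underlying real manifold with `g (J v, J w) = g (v, w)`. -/
structure HermitianMetric (F : Type*) [NormedAddCommGroup F] [NormedSpace ℂ F]
    (M : Type*) [TopologicalSpace M] [ChartedSpace F M] [IsManifold 𝓘(ℂ, F) ω M] extends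
    Bundle.ContMDiffRiemannianMetric (realModel F) ∞ F
      (fun x : M => TangentSpace (realModel F) x) where
  hermitian (x : M) (v w : TangentSpace (realModel F) x) :
    inner x (complexStructure x v) (complexStructure x w) = inner x v w

namespace HermitianMetric

variable {F : Type*} [NormedAddCommGroup F] [NormedSpace ℂ F]
  {M : Type*} [TopologicalSpace M] [ChartedSpace F M] [IsManifold 𝓘(ℂ, F) ω M]

/-- The fundamental form `Ω (v, w) = g (J v, w)` at the point `x`. -/
def fundamentalForm (g : HermitianMetric F M) (x : M) :
    TangentSpace (realModel F) x [⋀^Fin 2]→L[ℝ] ℝ :=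
  formOfBilin (F := F) (g.inner x) (g.symm x) (g.hermitian x)

/-- The fundamental form in the chart `e`: its pull-back under `e⁻¹`, a differential form on the
open subset `e.target` of `F`. -/
def localForm (g : HermitianMetric F M) (e : OpenPartialHomeomorph M F) (y : F) :
    F [⋀^Fin 2]→L[ℝ] ℝ :=
  (g.fundamentalForm (e.symm y)).compContinuousLinearMap
    (mfderiv (realModel F) (realModel F) e.symm y)

/-- The form `dᶜ Ω (u, v, w) = - dΩ (J u, J v, J w)` in the chart `e`. Minus this form is the torsion
`3`-form of the Bismut connection. -/
def localDc (g : HermitianMetric F M) (e : OpenPartialHomeomorph M F) (y : F) :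
    F [⋀^Fin 3]→L[ℝ] ℝ :=
  -(extDeriv (g.localForm e) y).compContinuousLinearMap (mulI F)

/-- The metric is Kähler: `dΩ = 0`. -/
def IsKahler (g : HermitianMetric F M) : Prop :=
  ∀ e ∈ atlas F M, ∀ y ∈ e.target, extDeriv (g.localForm e) y = 0

/-- The metric is pluriclosed, also called strong Kähler with torsion (SKT): `d dᶜ Ω = 0`. -/
def IsSKT (g : HermitianMetric F M) : Prop :=
  ∀ e ∈ atlas F M, ∀ y ∈ e.target, extDeriv (g.localDc e) y = 0

end HermitianMetric

/-! ### Free and properly discontinuous actions of `ℤ` -/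

/-- An action of `ℤ` for which some continuous real function `τ` satisfies `τ (n + x) = τ x + n` is
properly discontinuous. -/
lemma properlyDiscontinuousVAdd_of_translation {N : Type*} [TopologicalSpace N] [AddAction ℤ N]
    (τ : N → ℝ) (hτ : Continuous τ) (h : ∀ (n : ℤ) (x : N), τ (n +ᵥ x) = τ x + n) :
    ProperlyDiscontinuousVAdd ℤ N where
  finite_disjoint_inter_image := by
    intro A B hA hB
    obtain ⟨a, ha⟩ := (hA.image hτ).isBounded.subset_closedBall 0
    obtain ⟨b, hb⟩ := (hB.image hτ).isBounded.subset_closedBall 0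
    refine (Set.finite_Icc (-⌈a + b⌉) ⌈a + b⌉).subset ?_
    rintro n ⟨_, ⟨x, hx, rfl⟩, hy⟩
    have h1 := ha ⟨x, hx, rfl⟩
    have h2 := hb ⟨_, hy, rfl⟩
    simp only [h, Metric.mem_closedBall, Real.dist_eq, sub_zero, abs_le] at h1 h2
    have h3 : (a + b : ℝ) ≤ ⌈a + b⌉ := Int.le_ceil _
    constructor
    · have : ((-⌈a + b⌉ : ℤ) : ℝ) ≤ n := by push_cast; linarith
      exact_mod_cast this
    · have : (n : ℝ) ≤ (⌈a + b⌉ : ℤ) := by linarith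
      exact_mod_cast this

/-- An action of `ℤ` for which some real function `τ` satisfies `τ (n + x) = τ x + n` is free. -/
lemma isCancelVAdd_of_translation {N : Type*} [AddAction ℤ N]
    (τ : N → ℝ) (h : ∀ (n : ℤ) (x : N), τ (n +ᵥ x) = τ x + n) : IsCancelVAdd ℤ N where
  left_cancel' a _ _ hbc := by simpa using congrArg (fun x => -a +ᵥ x) hbc
  right_cancel' a b c hab := by
    have h1 := congrArg τ hab
    rw [h, h] at h1
    exact_mod_cast add_left_cancel h1

/-! ### The mapping torus -/

/-- The product `M × ℝ`, with the action `n + (p, t) = (fⁿ p, t + n)` of `ℤ`. -/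
def MappingTorusCover {M : Type*} [TopologicalSpace M] (_f : M ≃ₜ M) : Type _ := M × ℝ

section MappingTorus

variable {M : Type*} [TopologicalSpace M] (f : M ≃ₜ M)

instance : TopologicalSpace (MappingTorusCover f) := inferInstanceAs (TopologicalSpace (M × ℝ))

instance [T2Space M] : T2Space (MappingTorusCover f) := inferInstanceAs (T2Space (M × ℝ))

instance [LocallyCompactSpace M] : LocallyCompactSpace (MappingTorusCover f) :=
  inferInstanceAs (LocallyCompactSpace (M × ℝ))

instance {H : Type*} [TopologicalSpace H] [ChartedSpace H M] :
    ChartedSpace (ModelProd H ℝ) (MappingTorusCover f) :=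
  inferInstanceAs (ChartedSpace (ModelProd H ℝ) (M × ℝ))

instance : AddAction ℤ (MappingTorusCover f) where
  vadd n x := ((f ^ n) x.1, x.2 + n)
  zero_vadd x := by
    refine Prod.ext ?_ ?_
    · change (f ^ (0 : ℤ)) x.1 = x.1
      simp
    · change x.2 + ((0 : ℤ) : ℝ) = x.2
      simp
  add_vadd m n x := by
    change ((f ^ (m + n)) x.1, x.2 + ((m + n : ℤ) : ℝ)) =
      ((f ^ m) ((f ^ n) x.1), x.2 + (n : ℝ) + (m : ℝ))
    rw [zpow_add]
    refine Prod.ext rfl ?_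
    push_cast
    ring

instance : ContinuousConstVAdd ℤ (MappingTorusCover f) where
  continuous_const_vadd n :=
    ((f ^ n).continuous.comp continuous_fst).prodMk (continuous_snd.add continuous_const)

instance : ProperlyDiscontinuousVAdd ℤ (MappingTorusCover f) :=
  properlyDiscontinuousVAdd_of_translation (fun x => x.2) continuous_snd fun _ _ => rfl

instance : IsCancelVAdd ℤ (MappingTorusCover f) :=
  isCancelVAdd_of_translation (fun x => x.2) fun _ _ => rfl

/-- The mapping torus `M_f`, the quotient of `M × ℝ` by the action `(p, t) ↦ (fⁿ p, t + n)` of `ℤ`.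
If `M` has charts, then `M_f` carries the quotient charts
(`AddAction.instChartedSpaceQuotient`): local inverses of the projection `M × ℝ → M_f`, followed
by charts of the product `M × ℝ`. -/
abbrev MappingTorus : Type _ := AddAction.orbitRel.Quotient ℤ (MappingTorusCover f)

/-- The class of `(p, t)` in the mapping torus. -/
def MappingTorus.mk (p : M) (t : ℝ) : MappingTorus f :=
  Quotient.mk _ (show MappingTorusCover f from (p, t))

end MappingTorus

/-! ### The quotient of `K × (ℂ² \ {0})` -/

/-- The space `ℂ²` with its standard Hermitian norm. -/
abbrev C2 : Type := EuclideanSpace ℂ (Fin 2)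

/-- The open subset `ℂ² \ {0}` of `ℂ²`. -/
abbrev puncturedC2 : TopologicalSpace.Opens C2 := ⟨{0}ᶜ, isOpen_compl_singleton⟩

/-- The unit sphere of `ℂ²`. -/
abbrev S3 : Type := Metric.sphere (0 : C2) 1

instance : Fact (Module.finrank ℝ C2 = 3 + 1) :=
  ⟨by rw [← Module.finrank_mul_finrank ℝ ℂ C2]; simp⟩

instance : LocallyCompactSpace puncturedC2 := puncturedC2.isOpen.locallyCompactSpace

/-- The point `r z` of `ℂ² \ {0}`, for a real number `r > 0`. -/
def scalePunctured (r : ℝ) (hr : 0 < r) (z : C2) (hz : z ≠ 0) : puncturedC2 :=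
  ⟨r • z, smul_ne_zero hr.ne' hz⟩

/-- The product `K × (ℂ² \ {0})`, with the action `n + (p, z) = (ψⁿ p, 2ⁿ z)` of `ℤ`. -/
def HopfCover {K : Type*} [TopologicalSpace K] (_ψ : K ≃ₜ K) : Type _ := K × puncturedC2

section HopfQuotient

variable {K : Type*} [TopologicalSpace K] (ψ : K ≃ₜ K)

instance : TopologicalSpace (HopfCover ψ) := inferInstanceAs (TopologicalSpace (K × puncturedC2))

instance [T2Space K] : T2Space (HopfCover ψ) := inferInstanceAs (T2Space (K × puncturedC2))

instance [LocallyCompactSpace K] : LocallyCompactSpace (HopfCover ψ) :=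
  inferInstanceAs (LocallyCompactSpace (K × puncturedC2))

instance {H : Type*} [TopologicalSpace H] [ChartedSpace H K] :
    ChartedSpace (ModelProd H C2) (HopfCover ψ) :=
  inferInstanceAs (ChartedSpace (ModelProd H C2) (K × puncturedC2))

instance : AddAction ℤ (HopfCover ψ) where
  vadd n x := ((ψ ^ n) x.1, scalePunctured ((2 : ℝ) ^ n) (by positivity) x.2 x.2.2)
  zero_vadd x := by
    refine Prod.ext ?_ (Subtype.ext ?_)
    · change (ψ ^ (0 : ℤ)) x.1 = x.1
      simp
    · change ((2 : ℝ) ^ (0 : ℤ)) • (x.2 : C2) = x.2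
      simp
  add_vadd m n x := by
    refine Prod.ext ?_ (Subtype.ext ?_)
    · change (ψ ^ (m + n)) x.1 = (ψ ^ m) ((ψ ^ n) x.1)
      rw [zpow_add]
      rfl
    · change ((2 : ℝ) ^ (m + n)) • (x.2 : C2) = ((2 : ℝ) ^ m) • ((2 : ℝ) ^ n) • (x.2 : C2)
      rw [zpow_add₀ two_ne_zero, mul_smul]

instance : ContinuousConstVAdd ℤ (HopfCover ψ) where
  continuous_const_vadd n :=
    ((ψ ^ n).continuous.comp continuous_fst).prodMk
      (((continuous_subtype_val.comp continuous_snd).const_smul ((2 : ℝ) ^ n)).subtype_mk _)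

lemma HopfCover.continuous_logb :
    Continuous fun x : HopfCover ψ => Real.logb 2 ‖(x.2 : C2)‖ :=
  ((continuous_subtype_val.comp continuous_snd).norm.log
    fun x => norm_ne_zero_iff.2 x.2.2).div_const _

lemma HopfCover.logb_vadd (n : ℤ) (x : HopfCover ψ) :
    Real.logb 2 ‖((n +ᵥ x).2 : C2)‖ = Real.logb 2 ‖(x.2 : C2)‖ + n := by
  change Real.logb 2 ‖((2 : ℝ) ^ n) • (x.2 : C2)‖ = _
  have h2 : ‖(2 : ℝ) ^ n‖ = 2 ^ n := by simp
  have h3 : (2 : ℝ) ^ n ≠ 0 := by positivity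
  rw [norm_smul, h2, Real.logb_mul h3 (norm_ne_zero_iff.2 x.2.2), add_comm, ← Real.rpow_intCast,
    Real.logb_rpow two_pos (by norm_num)]

instance : ProperlyDiscontinuousVAdd ℤ (HopfCover ψ) :=
  properlyDiscontinuousVAdd_of_translation _ (HopfCover.continuous_logb ψ) (HopfCover.logb_vadd ψ)

instance : IsCancelVAdd ℤ (HopfCover ψ) :=
  isCancelVAdd_of_translation (fun x : HopfCover ψ => Real.logb 2 ‖(x.2 : C2)‖)
    (HopfCover.logb_vadd ψ)

/-- The quotient `(K × (ℂ² \ {0})) / ℤ` by the action `(p, z) ↦ (ψⁿ p, 2ⁿ z)`. If `K` has charts,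
then it carries the quotient charts (`AddAction.instChartedSpaceQuotient`): local inverses of the
projection from `K × (ℂ² \ {0})`, followed by charts of this product. -/
abbrev HopfQuotient : Type _ := AddAction.orbitRel.Quotient ℤ (HopfCover ψ)

/-- The class of `(p, z)` in the quotient `(K × (ℂ² \ {0})) / ℤ`. -/
def HopfQuotient.mk (x : K × puncturedC2) : HopfQuotient ψ :=
  Quotient.mk _ (show HopfCover ψ from x)

/-- The mapping torus of `(ψ, Id)` on `K × S³`. -/
abbrev SphereMappingTorus : Type _ :=
  MappingTorus (ψ.prodCongr (Homeomorph.refl S3))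

end HopfQuotient

end

/-! Polar coordinates `(p, q, t) ↦ (p, 2ᵗ q)` identify `K × S³ × ℝ` with `K × (ℂ² \ {0})`. Since
`2^(t+n) = 2ⁿ 2ᵗ`, they are equivariant for the two actions of `ℤ`, so `Φ` is a homeomorphism of the
quotients (`mappingTorusHomeomorph`). The complex atlas on the mapping torus is the one induced by
`mappingTorusProj`, the projection to `X` followed by `Φ⁻¹`. The deck transformations `(p, z) ↦ (ψⁿ
p, 2ⁿ z)` are holomorphic, so this projection is a local biholomorphism, and `Φ` is holomorphic in
both directions. The smooth structure is the given one because polar coordinates are a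
diffeomorphism.

The metric `g + |z|⁻² g_E` is invariant under the deck transformations: `ψ` is an isometry, and
multiplication by `2ⁿ` scales `g_E` by `4ⁿ` and `|z|⁻²` by `4⁻ⁿ`. Hence it descends to a Hermitian
metric (`HermitianMetric.exists_descend`, `HermitianMetric.hopfBilin_map`).

The SKT condition is local, and every chart is a local inverse of the projection followed by a
product chart. There `Ω` is the sum of the Kähler form of `K` and of `|z|⁻² ω_E`, and the first
summand is closed. What remains is a `4`-form pulled back from `ℂ²`, which has real dimension four,
so a single coefficient has to vanish (`extDeriv_dc_hopfForm`). Geometrically, `dᶜ(|z|⁻² ω_E)` is a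
constant multiple of the volume form of `S³` pulled back along `z ↦ z/|z|`, hence closed. -/

/-! ### Quotient manifolds -/

section QuotientManifold

open Set Filter

variable {𝕜 : Type*} [NontriviallyNormedField 𝕜] {E H : Type*} [NormedAddCommGroup E]
  [NormedSpace 𝕜 E] [TopologicalSpace H] (I : ModelWithCorners 𝕜 E H) (n : WithTop ℕ∞)
  {E' H' : Type*} [NormedAddCommGroup E'] [NormedSpace 𝕜 E'] [TopologicalSpace H']
  {J : ModelWithCorners 𝕜 E' H'}
  {E'' H'' : Type*} [NormedAddCommGroup E''] [NormedSpace 𝕜 E''] [TopologicalSpace H'']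
  {J' : ModelWithCorners 𝕜 E'' H''}
  {N M P : Type*} [TopologicalSpace N] [TopologicalSpace M] [TopologicalSpace P]
  [ChartedSpace H N] [ChartedSpace H' P]

/-- Any two points in a fibre of `f` are related by a local `C^n` deck transformation of `f`. -/
def HasLocalDeckTransformations (f : N → M) : Prop :=
  ∀ x x', f x = f x' → ∃ σ : N → N, ContMDiffAt I I n σ x ∧ σ x = x' ∧ f ∘ σ =ᶠ[𝓝 x] f

variable {I n} {f : N → M}

/-- Near `x`, both `s ∘ f` and the deck transformation moving `x` to `s (f x)` are lifts of `f` with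
values in `s.target`, where `f` is injective; so they coincide. -/
lemma HasLocalDeckTransformations.contMDiffAt_localInverse_comp
    (hd : HasLocalDeckTransformations I n f) (s : OpenPartialHomeomorph M N) (hs : ⇑s.symm = f)
    {x : N} (hx : f x ∈ s.source) : ContMDiffAt I I n (s ∘ f) x := by
  have h1 : f (s (f x)) = f x := by rw [← hs]; exact s.left_inv (by rwa [hs])
  obtain ⟨σ, hσ, hσx, hσf⟩ := hd x (s (f x)) h1.symm
  refine hσ.congr_of_eventuallyEq ?_
  have h2 : ∀ᶠ y in 𝓝 x, σ y ∈ s.target := by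
    refine hσ.continuousAt.eventually (s.open_target.mem_nhds ?_)
    rw [hσx]
    exact s.map_source hx
  filter_upwards [hσf, h2] with y hy hy'
  have : f (σ y) = f y := hy
  rw [Function.comp_apply, ← this, ← hs]
  exact s.right_inv hy'

/-- Every chart of `M` is a local inverse of `f : N → M`, followed by a chart of `N`. -/
def ChartsDescend (H : Type*) [TopologicalSpace H] {N M : Type*} [TopologicalSpace N]
    [TopologicalSpace M] [ChartedSpace H N] [ChartedSpace H M] (f : N → M) : Prop :=
  ∀ e ∈ atlas H M, ∃ (s : OpenPartialHomeomorph M N) (c : OpenPartialHomeomorph N H),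
    c ∈ atlas H N ∧ ⇑s.symm = f ∧ e = s.trans c

lemma IsLocalHomeomorph.chartsDescend_chartedSpace (hf : IsLocalHomeomorph f)
    (hs : Function.Surjective f) :
    letI : ChartedSpace H M := hf.chartedSpace hs
    ChartsDescend H f := by
  rintro e ⟨q, rfl⟩
  exact ⟨_, _, chart_mem_atlas H _, hf.localInverseAt_symm _, rfl⟩

/-- On the model space the only chart is the identity, so manifold smoothness is smoothness after
conjugation by `I`; this is the form `isManifold_of_contDiffOn` asks for. -/
lemma contDiffOn_of_contMDiffOn_model {g : H → H} {s : Set H}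
    (h : ContMDiffOn I I n g s) :
    ContDiffOn 𝕜 n (I ∘ g ∘ I.symm) (I.symm ⁻¹' s ∩ range I) := by
  rintro y ⟨hy, x, rfl⟩
  have hx : x ∈ s := by simpa using hy
  have := ((contMDiffWithinAt_iff).1 (h x hx)).2
  simpa only [mfld_simps, chartAt_self_eq] using this

variable [ChartedSpace H M]

variable (I n) in
/-- If the charts of `M` come from those of `N` via `f : N → M`, and the local deck
transformations of `f` are `C^n`, then `M` is a `C^n` manifold. -/
theorem HasLocalDeckTransformations.isManifold [IsManifold I n N] (hc : ChartsDescend H f)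
    (hd : HasLocalDeckTransformations I n f) : IsManifold I n M := by
  refine isManifold_of_contDiffOn I n M fun e e' he he' => ?_
  obtain ⟨s, c, hcN, hs, rfl⟩ := hc e he
  obtain ⟨s', c', hcN', hs', rfl⟩ := hc e' he'
  refine contDiffOn_of_contMDiffOn_model ?_
  intro y hy
  refine ContMDiffAt.contMDiffWithinAt ?_
  simp only [OpenPartialHomeomorph.trans_source, OpenPartialHomeomorph.symm_source,
    mem_inter_iff, mem_preimage,
    OpenPartialHomeomorph.trans_symm_eq_symm_trans_symm,
    OpenPartialHomeomorph.coe_trans, Function.comp_apply, hs] at hy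
  obtain ⟨⟨hy1, hy2⟩, hy3, hy4⟩ := hy
  -- Because `s.symm = f`, the coordinate change is `c' ∘ (s' ∘ f) ∘ c.symm`, and the middle factor
  -- is a local deck transformation.
  have k1 : ContMDiffAt I I n c.symm y := contMDiffAt_symm_of_mem_maximalAtlas
    (IsManifold.subset_maximalAtlas hcN) hy1
  have k2 : ContMDiffAt I I n (s' ∘ f) (c.symm y) := hd.contMDiffAt_localInverse_comp s' hs' hy3
  have k3 : ContMDiffAt I I n c' ((s' ∘ f) (c.symm y)) := contMDiffAt_of_mem_maximalAtlas
    (IsManifold.subset_maximalAtlas hcN') hy4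
  have := (k3.comp _ k2).comp y k1
  rw [OpenPartialHomeomorph.coe_trans, OpenPartialHomeomorph.coe_trans,
    OpenPartialHomeomorph.trans_symm_eq_symm_trans_symm, OpenPartialHomeomorph.coe_trans, hs]
  exact this

variable (I n) in
-- The local inverse `s₁` inside the preferred chart at `y` is `C^n` by construction of the atlas;
-- any other one is `(s ∘ f) ∘ s₁` near `y`, which differs from it by a deck transformation.
lemma HasLocalDeckTransformations.contMDiffAt_localInverse [IsManifold I n N] [IsManifold I n M]
    (hc : ChartsDescend H f) (hd : HasLocalDeckTransformations I n f)
    (s : OpenPartialHomeomorph M N) (hs : ⇑s.symm = f) {y : M} (hy : y ∈ s.source) :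
    ContMDiffAt I I n s y := by
  obtain ⟨s₁, c, hcN, hs₁, he⟩ := hc (chartAt H y) (chart_mem_atlas H y)
  have hy1 : y ∈ (s₁.trans c).source := he ▸ mem_chart_source H y
  have hy2 : y ∈ s₁.source := hy1.1
  have hy3 : s₁ y ∈ c.source := hy1.2
  have h1 : ContMDiffAt I I n s₁ y := by
    have k1 : ContMDiffAt I I n (s₁.trans c) y := by
      rw [← he]
      exact contMDiffAt_of_mem_maximalAtlas (IsManifold.chart_mem_maximalAtlas y)
        (mem_chart_source H y)
    have k2 : ContMDiffAt I I n c.symm (s₁.trans c y) := contMDiffAt_symm_of_mem_maximalAtlas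
      (IsManifold.subset_maximalAtlas hcN) (c.map_source hy3)
    refine (k2.comp y k1).congr_of_eventuallyEq ?_
    filter_upwards [(s₁.trans c).open_source.mem_nhds hy1] with z hz
    exact (c.left_inv hz.2).symm
  have hfs : ∀ z ∈ s₁.source, f (s₁ z) = z := fun z hz => by
    rw [← hs₁]; exact s₁.left_inv hz
  have h2 : ContMDiffAt I I n (s ∘ f) (s₁ y) :=
    hd.contMDiffAt_localInverse_comp s hs (by rwa [hfs y hy2])
  refine (h2.comp y h1).congr_of_eventuallyEq ?_
  filter_upwards [s₁.open_source.mem_nhds hy2] with z hz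
  simp [hfs z hz]

variable (I n) in
lemma HasLocalDeckTransformations.contMDiff [IsManifold I n N] [IsManifold I n M]
    (hf : Continuous f) (hc : ChartsDescend H f) (hd : HasLocalDeckTransformations I n f) :
    ContMDiff I I n f := by
  intro x
  obtain ⟨s, c, hcN, hs, he⟩ := hc (chartAt H (f x)) (chart_mem_atlas H _)
  have hy1 : f x ∈ (s.trans c).source := he ▸ mem_chart_source H (f x)
  have hfs : ∀ z ∈ s.source, f (s z) = z := fun z hz => by
    rw [← hs]; exact s.left_inv hz
  have k1 : ContMDiffAt I I n (s ∘ f) x := hd.contMDiffAt_localInverse_comp s hs hy1.1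
  have k2 : ContMDiffAt I I n c ((s ∘ f) x) :=
    contMDiffAt_of_mem_maximalAtlas (IsManifold.subset_maximalAtlas hcN) hy1.2
  have k3 : ContMDiffAt I I n (s.trans c).symm (c ((s ∘ f) x)) := by
    rw [← he]
    refine contMDiffAt_symm_of_mem_maximalAtlas (IsManifold.chart_mem_maximalAtlas _) ?_
    rw [he]
    exact (s.trans c).map_source hy1
  refine (k3.comp x (k2.comp x k1)).congr_of_eventuallyEq ?_
  filter_upwards [hf.continuousAt.preimage_mem_nhds ((s.trans c).open_source.mem_nhds hy1)] with z hz
  exact ((s.trans c).left_inv hz).symm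

/-- If the charts of `M` come from those of `N` via `f : N → M`, and the local deck
transformations of `f` are `C^n`, then `f` is a local diffeomorphism. -/
theorem HasLocalDeckTransformations.isLocalDiffeomorph [IsManifold I n N] [IsManifold I n M]
    (hf : IsLocalHomeomorph f) (hc : ChartsDescend H f)
    (hd : HasLocalDeckTransformations I n f) : IsLocalDiffeomorph I I n f := by
  intro x
  refine ⟨⟨(hf.localInverseAt x).symm.toPartialEquiv, OpenPartialHomeomorph.open_source _,
    OpenPartialHomeomorph.open_target _, ?_, ?_⟩, hf.self_mem_localInverseAt_target, ?_⟩
  · intro y _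
    have := hd.contMDiff I n hf.continuous hc y
    rw [← hf.localInverseAt_symm x] at this
    exact this.contMDiffWithinAt
  · intro y hy
    exact (hd.contMDiffAt_localInverse I n hc _ (hf.localInverseAt_symm x) hy).contMDiffWithinAt
  · intro y _
    exact (congrFun (hf.localInverseAt_symm x) y).symm

/-- A map out of the image of a surjective local diffeomorphism is `C^n` as soon as its
composition with the local diffeomorphism is. -/
theorem IsLocalDiffeomorph.contMDiff_of_comp {Q : Type*} [TopologicalSpace Q]
    [ChartedSpace H'' Q] {f : N → P} {g : P → Q} (hf : IsLocalDiffeomorph I J n f)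
    (hs : Function.Surjective f) (hg : ContMDiff I J' n (g ∘ f)) : ContMDiff J J' n g := by
  intro y
  obtain ⟨x, rfl⟩ := hs y
  have h1 := (hf x).localInverse_contMDiffAt
  refine ((hg _).comp (f x) h1).congr_of_eventuallyEq ?_
  filter_upwards [(hf x).localInverse_eventuallyEq_right] with z hz
  exact (congrArg g hz).symm

end QuotientManifold

/-! ### Differentials of real manifolds as maps of the model spaces -/

section RealDeriv

open Filter

variable {V W X : Type*} [NormedAddCommGroup V] [NormedSpace ℝ V] [NormedAddCommGroup W]
  [NormedSpace ℝ W] [NormedAddCommGroup X] [NormedSpace ℝ X]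
  {N M P : Type*} [TopologicalSpace N] [ChartedSpace V N] [TopologicalSpace M] [ChartedSpace W M]
  [TopologicalSpace P] [ChartedSpace X P]

/-- The differential of a map between real manifolds without boundary, as a map between the model
vector spaces. -/
noncomputable def realDeriv (V W : Type*) [NormedAddCommGroup V] [NormedSpace ℝ V]
    [NormedAddCommGroup W] [NormedSpace ℝ W] {N M : Type*} [TopologicalSpace N] [ChartedSpace V N]
    [TopologicalSpace M] [ChartedSpace W M] (f : N → M) (x : N) : V →L[ℝ] W :=
  mfderiv 𝓘(ℝ, V) 𝓘(ℝ, W) f x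

lemma realDeriv_comp {g : M → P} {f : N → M} {x : N}
    (hg : MDifferentiableAt 𝓘(ℝ, W) 𝓘(ℝ, X) g (f x))
    (hf : MDifferentiableAt 𝓘(ℝ, V) 𝓘(ℝ, W) f x) :
    realDeriv V X (g ∘ f) x = (realDeriv W X g (f x)).comp (realDeriv V W f x) :=
  mfderiv_comp x hg hf

lemma Filter.EventuallyEq.realDeriv_eq {f f' : N → M} {x : N} (h : f =ᶠ[𝓝 x] f') :
    realDeriv V W f x = realDeriv V W f' x :=
  h.mfderiv_eq

lemma realDeriv_eq_fderiv {f : V → W} : realDeriv V W f = fderiv ℝ f := by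
  ext x
  rw [realDeriv, mfderiv_eq_fderiv]

end RealDeriv

/-! ### Smoothness of metrics, tested in charts -/

section Metrics

open Set Filter Bundle

variable {F : Type*} [NormedAddCommGroup F] [NormedSpace ℂ F]
  {M : Type*} [TopologicalSpace M] [ChartedSpace F M] [IsManifold 𝓘(ℂ, F) ω M]

namespace HermitianMetric

/-- A Hermitian metric at a point, as a bilinear form on the model vector space. -/
noncomputable def bilin (g : HermitianMetric F M) (x : M) : F →L[ℝ] F →L[ℝ] ℝ := g.inner x

variable (g : HermitianMetric F M) (x : M)

lemma bilin_symm (v w : F) : g.bilin x v w = g.bilin x w v := g.symm x v w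

lemma bilin_pos {v : F} (hv : v ≠ 0) : 0 < g.bilin x v v := g.pos x v hv

lemma bilin_I_smul (v w : F) : g.bilin x (Complex.I • v) (Complex.I • w) = g.bilin x v w :=
  g.hermitian x v w

lemma isVonNBounded_bilin : Bornology.IsVonNBounded ℝ {v : F | g.bilin x v v < 1} :=
  g.isVonNBounded x

end HermitianMetric

/-- The pull-back of a Hermitian metric under a smooth map depends smoothly on the point. -/
lemma HermitianMetric.contDiffAt_pullback (g : HermitianMetric F M) {V : Type*}
    [NormedAddCommGroup V] [NormedSpace ℝ V] {φ : V → M} {y : V}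
    (hφ : ContMDiffAt 𝓘(ℝ, V) (realModel F) ∞ φ y) (v w : V) :
    ContDiffAt ℝ ∞ (fun z => g.bilin (φ z) (realDeriv V F φ z v) (realDeriv V F φ z w)) y := by
  -- The differential applied to a constant vector `u` is a smooth section of the tangent bundle
  -- along `φ`; the smooth metric is then evaluated on two such sections.
  have hT (u : V) : ContMDiffAt 𝓘(ℝ, V) (realModel F).tangent ∞
      (fun z => TotalSpace.mk' F (E := fun x : M => TangentSpace (realModel F) x) (φ z)
        (mfderiv 𝓘(ℝ, V) (realModel F) φ z u)) y := by
    refine ContMDiffAt.clm_apply_of_inCoordinates (IB₁ := 𝓘(ℝ, V)) (b₁ := fun z : V => z) (F₁ := V)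
      (E₁ := TangentSpace 𝓘(ℝ, V)) (E₂ := fun x : M => TangentSpace (realModel F) x)
      (ϕ := fun z => mfderiv 𝓘(ℝ, V) (realModel F) φ z) (v := fun _ => u)
      (hφ.mfderiv_const (m := ∞) le_rfl) ?_ hφ
    exact contMDiffAt_vectorSpace_iff_contDiffAt.2 contDiffAt_const
  have hg := (g.contMDiff (φ y)).comp y hφ
  have h := ContMDiffAt.clm_bundle_apply₂ (b := φ) (F₁ := F) (F₂ := F) (F₃ := ℝ)
    (E₁ := fun x : M => TangentSpace (realModel F) x)
    (E₂ := fun x : M => TangentSpace (realModel F) x) (E₃ := Bundle.Trivial M ℝ)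
    hg (hT v) (hT w)
  rw [contMDiffAt_totalSpace] at h
  exact h.2.contDiffAt

/-- A basis of the finite-dimensional `W` identifies `W →L[ℝ] G` with a finite power of `G`, where
smoothness is componentwise. -/
lemma contDiffAt_clm_of_apply {V W G : Type*} [NormedAddCommGroup V] [NormedSpace ℝ V]
    [NormedAddCommGroup W] [NormedSpace ℝ W] [FiniteDimensional ℝ W]
    [NormedAddCommGroup G] [NormedSpace ℝ G] {n : WithTop ℕ∞} {B : V → W →L[ℝ] G} {y : V}
    (h : ∀ v, ContDiffAt ℝ n (fun z => B z v) y) : ContDiffAt ℝ n B y := by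
  let d := Module.finrank ℝ W
  have hd : d = Module.finrank ℝ (Fin d → ℝ) := (Module.finrank_fin_fun ℝ).symm
  let e₁ := ContinuousLinearEquiv.ofFinrankEq hd
  let e₂ := (e₁.arrowCongr (1 : G ≃L[ℝ] G)).trans (ContinuousLinearEquiv.piRing (Fin d))
  rw [← Function.id_comp B, ← e₂.symm_comp_self]
  exact e₂.symm.contDiff.contDiffAt.comp y (contDiffAt_pi.2 fun i => h _)

/-- A family of bilinear forms on the tangent spaces is smooth if its coefficients in the
preferred charts are. -/
lemma contMDiff_bilin_of_chartAt [FiniteDimensional ℝ F] (b : M → F →L[ℝ] F →L[ℝ] ℝ)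
    (hb : ∀ (x : M) (v w : F), ContDiffAt ℝ ∞ (fun y : F => b ((chartAt F x).symm y)
      (realDeriv F F (chartAt F x).symm y v) (realDeriv F F (chartAt F x).symm y w)) (chartAt F x x)) :
    ContMDiff (realModel F) ((realModel F).prod 𝓘(ℝ, F →L[ℝ] F →L[ℝ] ℝ)) ∞
      (fun x => TotalSpace.mk' (F →L[ℝ] F →L[ℝ] ℝ)
        (E := fun x : M => TangentSpace (realModel F) x →L[ℝ]
          TangentSpace (realModel F) x →L[ℝ] ℝ) x (b x)) := by
  let b' (x : M) : TangentSpace (realModel F) x →L[ℝ] TangentSpace (realModel F) x →L[ℝ] ℝ := b x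
  intro x₀
  change ContMDiffAt (realModel F) ((realModel F).prod 𝓘(ℝ, F →L[ℝ] F →L[ℝ] ℝ)) ∞
    (fun x => TotalSpace.mk' (F →L[ℝ] F →L[ℝ] ℝ)
      (E := fun x : M => TangentSpace (realModel F) x →L[ℝ]
        TangentSpace (realModel F) x →L[ℝ] ℝ) x (b' x)) x₀
  rw [contMDiffAt_hom_bundle]
  refine ⟨contMDiffAt_id, ?_⟩
  let c := chartAt F x₀
  let D : F → F →L[ℝ] F := realDeriv F F c.symm
  let B : F → F →L[ℝ] F →L[ℝ] ℝ := fun y =>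
    ContinuousLinearMap.bilinearComp (b' (c.symm y)) (D y) (D y)
  have hB : ContDiffAt ℝ ∞ B (c x₀) :=
    contDiffAt_clm_of_apply fun v => contDiffAt_clm_of_apply fun w => hb x₀ v w
  have hc : ContMDiffAt (realModel F) 𝓘(ℝ, F) ∞ c x₀ :=
    contMDiffAt_of_mem_maximalAtlas (IsManifold.chart_mem_maximalAtlas x₀) (mem_chart_source F x₀)
  refine (hB.contMDiffAt.comp x₀ hc).congr_of_eventuallyEq ?_
  filter_upwards [c.open_source.mem_nhds (mem_chart_source F x₀)] with x hx
  -- The inverse tangent trivialization at `x₀` is the differential of the inverse chart, so the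
  -- bilinear form in bundle coordinates is `B ∘ c`.
  have hD : (trivializationAt F (TangentSpace (realModel F)) x₀).symmL ℝ x = D (c x) := by
    rw [TangentBundle.symmL_trivializationAt hx]
    simp [D, mfderivWithin_univ]
    rfl
  ext v w
  have hx' : x ∈ (trivializationAt (F →L[ℝ] ℝ)
      (fun x : M => TangentSpace (realModel F) x →L[ℝ] ℝ) x₀).baseSet := by
    rw [hom_trivializationAt_baseSet]
    exact ⟨hx, Set.mem_univ _⟩
  have hxc : c.symm (c x) = x := c.left_inv hx
  have hB' : B (c x) v w = b' x (D (c x) v) (D (c x) w) := by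
    simp only [B]
    rw [hxc]
    rfl
  rw [ContinuousLinearMap.inCoordinates]
  simp only [ContinuousLinearMap.comp_apply, Trivialization.continuousLinearMapAt_apply,
    Trivialization.coe_linearMapAt_of_mem _ hx', hom_trivializationAt_apply,
    ContinuousLinearMap.inCoordinates, hD]
  simp [hB']
  rfl

end Metrics

/-! ### From holomorphic to real smooth maps -/

section RestrictScalars

open Set Filter

variable {F F' : Type*} [NormedAddCommGroup F] [NormedSpace ℂ F]
  [NormedAddCommGroup F'] [NormedSpace ℂ F']
  {M M' : Type*} [TopologicalSpace M] [ChartedSpace F M]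
  [TopologicalSpace M'] [ChartedSpace F' M'] {f : M → M'} {x : M} {s : Set M}

lemma HasMFDerivAt.restrictScalars_real {L : F →L[ℂ] F'}
    (h : HasMFDerivAt 𝓘(ℂ, F) 𝓘(ℂ, F') f x L) :
    HasMFDerivAt (realModel F) (realModel F') f x (L.restrictScalars ℝ) :=
  ⟨h.1, HasFDerivWithinAt.restrictScalars ℝ h.2⟩

lemma MDifferentiableAt.restrictScalars_real (h : MDifferentiableAt 𝓘(ℂ, F) 𝓘(ℂ, F') f x) :
    MDifferentiableAt (realModel F) (realModel F') f x :=
  let L : F →L[ℂ] F' := mfderiv 𝓘(ℂ, F) 𝓘(ℂ, F') f x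
  (HasMFDerivAt.restrictScalars_real (L := L) h.hasMFDerivAt).mdifferentiableAt

/-- The real differential of a holomorphic map is its complex differential with scalars restricted.
This is how holomorphy transports the complex structure, and with it the fundamental form. -/
lemma realDeriv_I_smul (h : MDifferentiableAt 𝓘(ℂ, F) 𝓘(ℂ, F') f x) (v : F) :
    realDeriv F F' f x (Complex.I • v) = Complex.I • realDeriv F F' f x v := by
  let L : F →L[ℂ] F' := mfderiv 𝓘(ℂ, F) 𝓘(ℂ, F') f x
  have hL : realDeriv F F' f x = L.restrictScalars ℝ :=
    (HasMFDerivAt.restrictScalars_real (L := L) h.hasMFDerivAt).mfderiv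
  rw [hL]
  exact L.map_smul Complex.I v

lemma ContMDiffWithinAt.restrictScalars_real {n : WithTop ℕ∞}
    (h : ContMDiffWithinAt 𝓘(ℂ, F) 𝓘(ℂ, F') n f s x) :
    ContMDiffWithinAt (realModel F) (realModel F') n f s x :=
  ⟨h.1, ContDiffWithinAt.restrict_scalars ℝ h.2⟩

lemma ContMDiff.restrictScalars_real {n : WithTop ℕ∞} (h : ContMDiff 𝓘(ℂ, F) 𝓘(ℂ, F') n f) :
    ContMDiff (realModel F) (realModel F') n f :=
  fun x => (h x).restrictScalars_real

lemma IsLocalDiffeomorph.restrictScalars_real {n : WithTop ℕ∞}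
    (h : IsLocalDiffeomorph 𝓘(ℂ, F) 𝓘(ℂ, F') n f) :
    IsLocalDiffeomorph (realModel F) (realModel F') n f := fun x =>
  let ⟨Φ, hx, hΦ⟩ := h x
  ⟨⟨Φ.toPartialEquiv, Φ.open_source, Φ.open_target,
    fun y hy => (Φ.contMDiffOn_toFun y hy).restrictScalars_real,
    fun y hy => (Φ.contMDiffOn_invFun y hy).restrictScalars_real⟩, hx, hΦ⟩

end RestrictScalars

/-! ### Descent of Hermitian metrics along local biholomorphisms -/

section Descent

open Set Filter

variable {F : Type*} [NormedAddCommGroup F] [NormedSpace ℂ F]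
  {N M : Type*} [TopologicalSpace N] [ChartedSpace F N] [IsManifold 𝓘(ℂ, F) ω N]
  [TopologicalSpace M] [ChartedSpace F M] [IsManifold 𝓘(ℂ, F) ω M] {π : N → M}

lemma HermitianMetric.localForm_apply (g : HermitianMetric F M) (e : OpenPartialHomeomorph M F)
    (y : F) (v : Fin 2 → F) :
    g.localForm e y v = g.bilin (e.symm y) (Complex.I • realDeriv F F e.symm y (v 0))
      (realDeriv F F e.symm y (v 1)) := rfl

/-- If `h` pulls back to `G` under `π`, then the fundamental forms of `h` and `G` agree in the chart
of `M` given by a chart of `N` and a local inverse of `π`. -/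
lemma HermitianMetric.localForm_trans (h : HermitianMetric F M) (G : HermitianMetric F N)
    (hπ : IsLocalDiffeomorph 𝓘(ℂ, F) 𝓘(ℂ, F) ω π)
    (hG : ∀ (x : N) (v w : F),
      h.bilin (π x) (realDeriv F F π x v) (realDeriv F F π x w) = G.bilin x v w)
    (s : OpenPartialHomeomorph M N) (hs : ⇑s.symm = π) {c : OpenPartialHomeomorph N F}
    (hc : c ∈ atlas F N) {y : F} (hy : y ∈ c.target) :
    h.localForm (s.trans c) y = G.localForm c y := by
  have h1 : ⇑(s.trans c).symm = π ∘ c.symm := by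
    rw [OpenPartialHomeomorph.trans_symm_eq_symm_trans_symm, OpenPartialHomeomorph.coe_trans, hs]
  have hd := hπ.mdifferentiable (n := ω) (by simp) (c.symm y)
  have hcd : MDifferentiableAt (realModel F) (realModel F) c.symm y :=
    mdifferentiableAt_atlas_symm hc hy
  ext v
  rw [localForm_apply, localForm_apply, h1, realDeriv_comp hd.restrictScalars_real hcd,
    ContinuousLinearMap.comp_apply, ContinuousLinearMap.comp_apply, ← realDeriv_I_smul hd,
    Function.comp_apply, hG]

/-- A Hermitian metric descends along a surjective local biholomorphism if it is invariant under
local deck transformations. -/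
theorem HermitianMetric.exists_descend [FiniteDimensional ℂ F] (G : HermitianMetric F N)
    (hπ : IsLocalDiffeomorph 𝓘(ℂ, F) 𝓘(ℂ, F) ω π) (hs : Function.Surjective π)
    (hG : ∀ x x', π x = π x' → ∃ σ : N → N, MDifferentiableAt (realModel F) (realModel F) σ x ∧
      σ x = x' ∧ π ∘ σ =ᶠ[𝓝 x] π ∧ ∀ v w : F,
        G.bilin (σ x) (realDeriv F F σ x v) (realDeriv F F σ x w) = G.bilin x v w) :
    ∃ h : HermitianMetric F M, ∀ (x : N) (v w : F),
      h.bilin (π x) (realDeriv F F π x v) (realDeriv F F π x w) = G.bilin x v w := by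
  have hπr : IsLocalDiffeomorph (realModel F) (realModel F) ω π := hπ.restrictScalars_real
  have hω : (ω : WithTop ℕ∞) ≠ 0 := by simp
  have hd (x : N) : MDifferentiableAt (realModel F) (realModel F) π x :=
    hπr.mdifferentiable hω x
  let e (x : N) : F ≃L[ℝ] F := hπr.mfderivToContinuousLinearEquiv hω x
  have he (x : N) (v : F) : e x v = realDeriv F F π x v := rfl
  let r : M → N := Function.surjInv hs
  have hr (y : M) : π (r y) = y := Function.surjInv_eq hs y
  -- `G` is transported along an arbitrary, possibly discontinuous, section `r`; by `hb` below, the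
  -- choice of the preimage does not matter.
  let b (y : M) : F →L[ℝ] F →L[ℝ] ℝ :=
    (G.bilin (r y)).bilinearComp ((e (r y)).symm : F →L[ℝ] F) ((e (r y)).symm : F →L[ℝ] F)
  have hb (x : N) (v w : F) :
      b (π x) (realDeriv F F π x v) (realDeriv F F π x w) = G.bilin x v w := by
    obtain ⟨σ, hσ, hσx, hσπ, hσG⟩ := hG x (r (π x)) (hr (π x)).symm
    -- Differentiating `π ∘ σ = π` at `x` shows that `dσ` is `dπ` at `x` followed by the inverse of
    -- `dπ` at `σ x`.
    have key (u : F) : (e (r (π x))).symm (realDeriv F F π x u) = realDeriv F F σ x u := by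
      rw [ContinuousLinearEquiv.symm_apply_eq, he, ← hσπ.realDeriv_eq,
        realDeriv_comp (hd _) hσ, ← hσx]
      rfl
    change G.bilin (r (π x)) ((e (r (π x))).symm (realDeriv F F π x v))
      ((e (r (π x))).symm (realDeriv F F π x w)) = _
    rw [key, key, ← hσG, hσx]
  -- Every tangent vector of `M` is of the form `dπ u`, so each pointwise axiom for `b` is read off
  -- from `G` through `hb`.
  have hlift (y : M) : ∃ x, π x = y ∧ ∀ v : F, ∃ u : F, realDeriv F F π x u = v :=
    (hs y).imp fun x hx => ⟨hx, fun v => (e x).surjective v⟩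
  have hsymm (y : M) (v w : F) : b y v w = b y w v := by
    obtain ⟨x, rfl, hx⟩ := hlift y
    obtain ⟨v, rfl⟩ := hx v
    obtain ⟨w, rfl⟩ := hx w
    rw [hb, hb, G.bilin_symm]
  have hpos (y : M) (v : F) (hv : v ≠ 0) : 0 < b y v v := by
    obtain ⟨x, rfl, hx⟩ := hlift y
    obtain ⟨v, rfl⟩ := hx v
    rw [hb]
    exact G.bilin_pos x fun h => hv (by rw [h, map_zero])
  have hbdd (y : M) : Bornology.IsVonNBounded ℝ {v : F | b y v v < 1} := by
    obtain ⟨x, rfl, hx⟩ := hlift y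
    refine ((G.isVonNBounded_bilin x).image (realDeriv F F π x)).subset ?_
    intro v hv
    obtain ⟨v, rfl⟩ := hx v
    exact ⟨v, (hb x v v).symm.trans_lt hv, rfl⟩
  have hherm (y : M) (v w : F) : b y (Complex.I • v) (Complex.I • w) = b y v w := by
    obtain ⟨x, rfl, hx⟩ := hlift y
    obtain ⟨v, rfl⟩ := hx v
    obtain ⟨w, rfl⟩ := hx w
    have hx := hπ.mdifferentiable hω x
    rw [← realDeriv_I_smul hx, ← realDeriv_I_smul hx, hb, hb, G.bilin_I_smul]
  have hFD : FiniteDimensional ℝ F := FiniteDimensional.complexToReal F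
  refine ⟨{ inner := b, symm := hsymm, pos := hpos, isVonNBounded := hbdd,
            contMDiff := contMDiff_bilin_of_chartAt b ?_, hermitian := hherm }, hb⟩
  intro y v w
  obtain ⟨x, rfl⟩ := hs y
  let c := chartAt F (π x)
  let s := (hπr x).localInverse
  have hc : ∀ z ∈ c.target, ContMDiffAt (realModel F) (realModel F) ∞ c.symm z := fun z hz =>
    contMDiffAt_symm_of_mem_maximalAtlas (IsManifold.chart_mem_maximalAtlas (π x)) hz
  have hsd : ∀ z ∈ s.source, ContMDiffAt (realModel F) (realModel F) ∞ s z := fun z hz =>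
    (s.contMDiffOn.contMDiffAt (s.open_source.mem_nhds hz)).of_le le_top
  have hcx : c (π x) ∈ c.target := c.map_source (mem_chart_source F (π x))
  have hxc : c.symm (c (π x)) = π x := c.left_inv (mem_chart_source F (π x))
  have hxs : π x ∈ s.source := (hπr x).localInverse_mem_source
  have hS : ∀ᶠ z in 𝓝 (c (π x)), z ∈ c.target ∧ c.symm z ∈ s.source :=
    (c.open_target.eventually_mem hcx).and ((hc _ hcx).continuousAt.eventually_mem
      (s.open_source.mem_nhds (by rwa [hxc])))
  have hφ : ∀ z, z ∈ c.target ∧ c.symm z ∈ s.source →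
      ContMDiffAt (realModel F) (realModel F) ∞ (s ∘ c.symm) z :=
    fun z hz => (hsd _ hz.2).comp z (hc z hz.1)
  have hπs : ∀ z, c.symm z ∈ s.source → π ((s ∘ c.symm) z) = c.symm z :=
    fun z hz => (hπr x).localInverse_right_inv hz
  -- Near `π x` the form `b` in the chart is the pull-back of `G` under the smooth map `s ∘ c.symm`,
  -- with `s` a local inverse of `π`; smoothness does not involve `r`.
  refine (G.contDiffAt_pullback (hφ _ hS.self_of_nhds) v w).congr_of_eventuallyEq ?_
  filter_upwards [hS.eventually_nhds] with z hz
  have h1 : c.symm =ᶠ[𝓝 z] π ∘ (s ∘ c.symm) := by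
    filter_upwards [hz] with z' hz'
    exact (hπs z' hz'.2).symm
  have h2 := hz.self_of_nhds
  rw [h1.realDeriv_eq, realDeriv_comp (hd _) ((hφ z h2).mdifferentiableAt (by simp)),
    ContinuousLinearMap.comp_apply, ContinuousLinearMap.comp_apply, ← hb]
  exact congrArg (fun y => b y _ _) (hπs z h2.2).symm

end Descent

lemma ContDiffAt.extDeriv {F G : Type*} [NormedAddCommGroup F] [NormedSpace ℝ F]
    [NormedAddCommGroup G] [NormedSpace ℝ G] {k : ℕ} {n : WithTop ℕ∞} {α : F → F [⋀^Fin k]→L[ℝ] G}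
    {x : F} (h : ContDiffAt ℝ (n + 1) α x) : ContDiffAt ℝ n (extDeriv α) x := by
  have h1 : _root_.extDeriv α = ContinuousAlternatingMap.alternatizeUncurryFinCLM ℝ F G ∘ fderiv ℝ α :=
    funext fun _ => (ContinuousAlternatingMap.alternatizeUncurryFinCLM_apply _).symm
  rw [h1]
  exact (ContinuousLinearMap.contDiff _).contDiffAt.comp x (h.fderiv_right le_rfl)

/-! ### The form `|z|⁻² ω_E` on `ℂ² \ {0}` is pluriclosed -/

section HopfForm

attribute [local instance] InnerProductSpace.complexToReal

variable {V : Type*} [NormedAddCommGroup V] [InnerProductSpace ℂ V]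

variable (V) in
/-- The Euclidean metric underlying a complex inner product. -/
noncomputable def reInner : V →L[ℝ] V →L[ℝ] ℝ := innerSL ℝ

lemma reInner_apply (v w : V) : reInner V v w = (inner ℂ v w).re := rfl

lemma reInner_comm (v w : V) : reInner V v w = reInner V w v := by
  rw [reInner_apply, reInner_apply, ← inner_conj_symm, Complex.conj_re]

lemma reInner_I_smul_I_smul (v w : V) :
    reInner V (Complex.I • v) (Complex.I • w) = reInner V v w := by
  simp [reInner_apply, ← mul_assoc]

lemma reInner_self (v : V) : reInner V v v = ‖v‖ ^ 2 := real_inner_self_eq_norm_sq v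

variable (V) in
/-- The fundamental form of the metric `reInner V`. -/
noncomputable def euclideanForm : V [⋀^Fin 2]→L[ℝ] ℝ :=
  formOfBilin (reInner V) reInner_comm reInner_I_smul_I_smul

lemma euclideanForm_apply (v : Fin 2 → V) :
    euclideanForm V v = reInner V (Complex.I • v 0) (v 1) := rfl

/-- The fundamental form of the metric `|z|⁻² g_E`. -/
noncomputable def hopfForm (z : V) : V [⋀^Fin 2]→L[ℝ] ℝ := (‖z‖ ^ 2)⁻¹ • euclideanForm V

lemma contDiffAt_inv_norm_sq {z : V} (hz : z ≠ 0) {n : WithTop ℕ∞} :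
    ContDiffAt ℝ n (fun z : V => (‖z‖ ^ 2)⁻¹) z :=
  (contDiff_norm_sq ℝ).contDiffAt.inv (by simpa using hz)

lemma contDiffAt_hopfForm {z : V} (hz : z ≠ 0) {n : WithTop ℕ∞} : ContDiffAt ℝ n hopfForm z :=
  (contDiffAt_inv_norm_sq hz).smul contDiffAt_const

lemma hasFDerivAt_inv_norm_sq {z : V} (hz : z ≠ 0) :
    HasFDerivAt (fun z : V => (‖z‖ ^ 2)⁻¹) (-(2 * ((‖z‖ ^ 2)⁻¹) ^ 2) • reInner V z) z := by
  have h1 : HasFDerivAt (fun z : V => ‖z‖ ^ 2) (2 • reInner V z) z :=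
    (hasStrictFDerivAt_norm_sq z).hasFDerivAt
  have h2 := (hasDerivAt_inv (x := ‖z‖ ^ 2) (by simpa using hz)).comp_hasFDerivAt z h1
  convert! h2 using 1
  ext v
  simp
  ring

lemma extDeriv_hopfForm {z : V} (hz : z ≠ 0) (v : Fin 3 → V) :
    extDeriv hopfForm z v = -(2 * ((‖z‖ ^ 2)⁻¹) ^ 2) *
      (reInner V z (v 0) * reInner V (Complex.I • v 1) (v 2) -
        reInner V z (v 1) * reInner V (Complex.I • v 0) (v 2) +
        reInner V z (v 2) * reInner V (Complex.I • v 0) (v 1)) := by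
  have h := (hasFDerivAt_inv_norm_sq hz).smul_const (euclideanForm V)
  rw [extDeriv, show hopfForm = fun z : V => (‖z‖ ^ 2)⁻¹ • euclideanForm V from rfl, h.fderiv,
    ContinuousAlternatingMap.alternatizeUncurryFin_apply, Fin.sum_univ_three]
  simp only [ContinuousLinearMap.smulRight_apply, ContinuousAlternatingMap.smul_apply,
    euclideanForm_apply, Fin.removeNth, Fin.succAbove, smul_eq_mul, smul_apply,
    zsmul_eq_mul]
  simp
  ring

/-- The form `-dᶜ` of `hopfForm`, in terms of the point and of three fixed vectors. -/
noncomputable def hopfFormDc (w : Fin 3 → V) (z : V) : ℝ :=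
  -(2 * ((‖z‖ ^ 2)⁻¹) ^ 2) *
      (reInner V z (Complex.I • w 0) * reInner V (Complex.I • w 1) (w 2) -
        reInner V z (Complex.I • w 1) * reInner V (Complex.I • w 0) (w 2) +
        reInner V z (Complex.I • w 2) * reInner V (Complex.I • w 0) (w 1))

lemma fderiv_hopfFormDc {z : V} (hz : z ≠ 0) (w : Fin 3 → V) (v : V) :
    fderiv ℝ (hopfFormDc w) z v =
      8 * ((‖z‖ ^ 2)⁻¹) ^ 3 * reInner V z v *
        (reInner V z (Complex.I • w 0) * reInner V (Complex.I • w 1) (w 2) -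
          reInner V z (Complex.I • w 1) * reInner V (Complex.I • w 0) (w 2) +
          reInner V z (Complex.I • w 2) * reInner V (Complex.I • w 0) (w 1)) -
      2 * ((‖z‖ ^ 2)⁻¹) ^ 2 *
        (reInner V v (Complex.I • w 0) * reInner V (Complex.I • w 1) (w 2) -
          reInner V v (Complex.I • w 1) * reInner V (Complex.I • w 0) (w 2) +
          reInner V v (Complex.I • w 2) * reInner V (Complex.I • w 0) (w 1)) := by
  -- The differential of `|z|⁻⁴` is `-4 |z|⁻⁶ ⟨z, ·⟩`; the factor `-2` turns this into the
  -- coefficient `8`.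
  have h1 := (((hasFDerivAt_inv_norm_sq hz).pow 2).const_mul 2).neg
  have h2 (a : V) : HasFDerivAt (fun z => reInner V z a) ((reInner V).flip a) z :=
    ((reInner V).flip a).hasFDerivAt
  have h3 := h1.mul ((((h2 (Complex.I • w 0)).mul_const (reInner V (Complex.I • w 1) (w 2))).sub
    ((h2 (Complex.I • w 1)).mul_const (reInner V (Complex.I • w 0) (w 2)))).add
    ((h2 (Complex.I • w 2)).mul_const (reInner V (Complex.I • w 0) (w 1))))
  have h4 : HasFDerivAt (hopfFormDc w) _ z := h3
  rw [h4.fderiv]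
  simp
  ring

lemma extDeriv_hopfForm_comp_mulI {z : V} (hz : z ≠ 0) (w : Fin 3 → V) :
    (extDeriv hopfForm z).compContinuousLinearMap (mulI V) w = hopfFormDc w z := by
  rw [ContinuousAlternatingMap.compContinuousLinearMap_apply, extDeriv_hopfForm hz]
  simp only [Function.comp_apply, mulI_apply, reInner_I_smul_I_smul, hopfFormDc]

lemma contDiffAt_extDeriv_hopfForm {z : V} (hz : z ≠ 0) {n : WithTop ℕ∞} :
    ContDiffAt ℝ n (fun z => (extDeriv hopfForm z).compContinuousLinearMap (mulI V)) z :=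
  (ContinuousAlternatingMap.compContinuousLinearMapCLM (mulI V)).contDiff.contDiffAt.comp z
    (contDiffAt_hopfForm hz).extDeriv

lemma extDeriv_extDeriv_hopfForm_comp_mulI {z : V} (hz : z ≠ 0) (v : Fin 4 → V) :
    extDeriv (fun z => (extDeriv hopfForm z).compContinuousLinearMap (mulI V)) z v =
      ∑ i : Fin 4, (-1) ^ (i : ℕ) • fderiv ℝ (hopfFormDc (i.removeNth v)) z (v i) := by
  rw [extDeriv_apply ((contDiffAt_extDeriv_hopfForm hz (n := 1)).differentiableAt (by simp))]
  refine Finset.sum_congr rfl fun i _ => ?_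
  congr 2
  refine Filter.EventuallyEq.fderiv_eq ?_
  filter_upwards [isOpen_ne.mem_nhds hz] with y hy
  exact extDeriv_hopfForm_comp_mulI hy _

noncomputable def realBasisC2 : Module.Basis (Fin 4) ℝ C2 :=
  (Complex.basisOneI.smulTower (EuclideanSpace.basisFun (Fin 2) ℂ).toBasis).reindex finProdFinEquiv

lemma realBasisC2_eq : (realBasisC2 : Fin 4 → C2) =
    ![EuclideanSpace.single 0 1, EuclideanSpace.single 1 1, EuclideanSpace.single 0 Complex.I,
      EuclideanSpace.single 1 Complex.I] := by
  ext i j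
  fin_cases i <;> fin_cases j <;>
    simp [realBasisC2, finProdFinEquiv, Module.Basis.smulTower_apply, Fin.modNat, Fin.divNat]

/-- A form of top degree is determined by its value on one basis; this is where the dimension of
`ℂ²` enters. -/
lemma alternating_four_eq_zero {f : C2 [⋀^Fin 4]→L[ℝ] ℝ}
    (h : f ![EuclideanSpace.single 0 1, EuclideanSpace.single 1 1, EuclideanSpace.single 0 Complex.I,
      EuclideanSpace.single 1 Complex.I] = 0) : f = 0 := by
  have := f.toAlternatingMap.eq_smul_basis_det realBasisC2
  rw [realBasisC2_eq, ContinuousAlternatingMap.coe_toAlternatingMap, h, zero_smul] at this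
  exact ContinuousAlternatingMap.toAlternatingMap_injective this

lemma reInner_C2 (v w : C2) : reInner C2 v w =
    (v 0).re * (w 0).re + (v 0).im * (w 0).im + ((v 1).re * (w 1).re + (v 1).im * (w 1).im) := by
  rw [reInner_apply, PiLp.inner_apply, Fin.sum_univ_two]
  simp
  ring

theorem extDeriv_dc_hopfForm {z : C2} (hz : z ≠ 0) :
    extDeriv (fun z => (extDeriv hopfForm z).compContinuousLinearMap (mulI C2)) z = 0 := by
  refine alternating_four_eq_zero ?_
  have hn := reInner_self z
  rw [reInner_C2] at hn
  have hz' : ‖z‖ ^ 2 ≠ 0 := by simpa using hz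
  rw [extDeriv_extDeriv_hopfForm_comp_mulI hz, Fin.sum_univ_four]
  simp only [fderiv_hopfFormDc hz, reInner_C2, Fin.removeNth, Fin.succAbove]
  simp
  -- On the real basis the derivatives of `|z|⁻⁴` contribute `8 |z|⁻⁶` times the sum of the four
  -- squared coordinates, that is `8 |z|⁻⁴`. The derivatives of the linear factor contribute `-2
  -- |z|⁻⁴` for each of the four basis vectors, and the two parts cancel.
  have h3 : ‖z‖ ^ 2 * ((‖z‖ ^ 2) ^ 3)⁻¹ = ((‖z‖ ^ 2) ^ 2)⁻¹ := by field_simp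
  linear_combination (8 * ((‖z‖ ^ 2) ^ 3)⁻¹) * hn + 8 * h3

end HopfForm

/-! ### Smoothness of the fundamental form in charts -/

section LocalForm

open Filter

lemma contDiffAt_alternating_of_apply {V W : Type*} [NormedAddCommGroup V] [NormedSpace ℝ V]
    [NormedAddCommGroup W] [NormedSpace ℝ W] [FiniteDimensional ℝ W] {n : WithTop ℕ∞} {k : ℕ}
    {f : V → W [⋀^Fin k]→L[ℝ] ℝ} {y : V} (h : ∀ v, ContDiffAt ℝ n (fun z => f z v) y) :
    ContDiffAt ℝ n f y := by
  induction k with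
  | zero =>
    have h1 : f = ContinuousAlternatingMap.constOfIsEmptyLIE ℝ W ℝ (Fin 0) ∘ fun z => f z 0 := by
      ext z v
      simp [Subsingleton.elim v 0]
    rw [h1]
    exact (LinearIsometryEquiv.contDiff _).contDiffAt.comp y (h 0)
  | succ k ih =>
    -- Alternatizing `curryLeft` of a `(k+1)`-form returns `k + 1` times the form; so the form
    -- depends smoothly on its contractions, which have degree `k`.
    have h1 : f = (fun α => (k + 1 : ℝ)⁻¹ • α) ∘
        ContinuousAlternatingMap.alternatizeUncurryFinCLM ℝ W ℝ ∘ fun z => (f z).curryLeft := by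
      funext z
      rw [Function.comp_apply, Function.comp_apply,
        ContinuousAlternatingMap.alternatizeUncurryFinCLM_apply,
        ContinuousAlternatingMap.alternatizeUncurryFin_curryLeft, ← Nat.cast_smul_eq_nsmul ℝ,
        smul_smul]
      push_cast
      rw [inv_mul_cancel₀ (by positivity), one_smul]
    rw [h1]
    have h2 : ContDiffAt ℝ n (fun z => (f z).curryLeft) y :=
      contDiffAt_clm_of_apply fun v => ih fun w => by simpa using h (Matrix.vecCons v w)
    have h3 : ContDiffAt ℝ n (ContinuousAlternatingMap.alternatizeUncurryFinCLM ℝ W ℝ ∘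
        fun z => (f z).curryLeft) y := (ContinuousLinearMap.contDiff _).contDiffAt.comp y h2
    exact (contDiff_const_smul _).contDiffAt.comp y h3

variable {F : Type*} [NormedAddCommGroup F] [NormedSpace ℂ F] [FiniteDimensional ℂ F]
  {M : Type*} [TopologicalSpace M] [ChartedSpace F M] [IsManifold 𝓘(ℂ, F) ω M]

/-- `localForm` multiplies by `i` after the differential, `contDiffAt_pullback` is used with `i`
before it; the two agree since inverse charts are holomorphic. -/
lemma HermitianMetric.contDiffAt_localForm (g : HermitianMetric F M)
    {e : OpenPartialHomeomorph M F} (he : e ∈ atlas F M) {y : F} (hy : y ∈ e.target) :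
    ContDiffAt ℝ ∞ (g.localForm e) y := by
  have := FiniteDimensional.complexToReal F
  refine contDiffAt_alternating_of_apply fun v => ?_
  have h1 : ContMDiffAt (realModel F) (realModel F) ∞ e.symm y :=
    contMDiffAt_symm_of_mem_maximalAtlas (IsManifold.subset_maximalAtlas he) hy
  refine (g.contDiffAt_pullback h1 (Complex.I • v 0) (v 1)).congr_of_eventuallyEq ?_
  filter_upwards [e.open_target.mem_nhds hy] with z hz
  rw [localForm_apply, realDeriv_I_smul (mdifferentiableAt_atlas_symm he hz)]

end LocalForm

/-! ### Charts and projections of `K × (ℂ² \ {0})` -/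

section ProductModel

variable {E : Type*} [NormedAddCommGroup E] [NormedSpace ℂ E]
  {K : Type*} [TopologicalSpace K] [ChartedSpace E K]

/-- The product charts of `K × (ℂ² \ {0})`, with values in the normed space `E × ℂ²`. -/
noncomputable instance chartedSpaceProdPunctured : ChartedSpace (E × C2) (K × puncturedC2) :=
  inferInstanceAs (ChartedSpace (ModelProd E C2) (K × puncturedC2))

/-- The charts are the same on both sides; only the models with corners differ, and these are equal
by `modelWithCornersSelf_prod` but not syntactically. -/
lemma contMDiff_model_prod_iff {H' E' P : Type*} [NormedAddCommGroup E'] [NormedSpace ℂ E']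
    [TopologicalSpace H'] {J : ModelWithCorners ℂ E' H'} [TopologicalSpace P] [ChartedSpace H' P]
    {n : WithTop ℕ∞} {f : K × puncturedC2 → P} :
    ContMDiff 𝓘(ℂ, E × C2) J n f ↔ ContMDiff (𝓘(ℂ, E).prod 𝓘(ℂ, C2)) J n f := by
  rw [modelWithCornersSelf_prod]

lemma contMDiff_prod_model_iff {H' E' P : Type*} [NormedAddCommGroup E'] [NormedSpace ℂ E']
    [TopologicalSpace H'] {J : ModelWithCorners ℂ E' H'} [TopologicalSpace P] [ChartedSpace H' P]
    {n : WithTop ℕ∞} {f : P → K × puncturedC2} :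
    ContMDiff J 𝓘(ℂ, E × C2) n f ↔ ContMDiff J (𝓘(ℂ, E).prod 𝓘(ℂ, C2)) n f := by
  rw [modelWithCornersSelf_prod]

instance [IsManifold 𝓘(ℂ, E) ω K] : IsManifold 𝓘(ℂ, E × C2) ω (K × puncturedC2) := by
  have h : IsManifold (𝓘(ℂ, E).prod 𝓘(ℂ, C2)) ω (K × puncturedC2) := inferInstance
  rw [modelWithCornersSelf_prod]
  exact h

/-- The second component of a point of `K × (ℂ² \ {0})`, as a vector. -/
def puncturedSnd (x : K × puncturedC2) : C2 := x.2

omit [TopologicalSpace K] in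
lemma puncturedSnd_ne_zero (x : K × puncturedC2) : puncturedSnd x ≠ 0 := x.2.2

lemma contMDiff_fst_model {n : WithTop ℕ∞} :
    ContMDiff 𝓘(ℂ, E × C2) 𝓘(ℂ, E) n (Prod.fst : K × puncturedC2 → K) :=
  contMDiff_model_prod_iff.2 contMDiff_fst

lemma contMDiff_puncturedSnd {n : WithTop ℕ∞} :
    ContMDiff 𝓘(ℂ, E × C2) 𝓘(ℂ, C2) n (puncturedSnd : K × puncturedC2 → C2) :=
  contMDiff_model_prod_iff.2 (contMDiff_subtype_val.comp contMDiff_snd)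

lemma mdifferentiableAt_fst_model (x : K × puncturedC2) :
    MDifferentiableAt 𝓘(ℝ, E × C2) 𝓘(ℝ, E) (Prod.fst : K × puncturedC2 → K) x :=
  (contMDiff_fst_model (n := ω)).restrictScalars_real.mdifferentiableAt (by simp)

lemma mdifferentiableAt_puncturedSnd (x : K × puncturedC2) :
    MDifferentiableAt 𝓘(ℝ, E × C2) 𝓘(ℝ, C2) (puncturedSnd : K × puncturedC2 → C2) x :=
  (contMDiff_puncturedSnd (n := ω)).restrictScalars_real.mdifferentiableAt (by simp)

omit [NormedSpace ℂ E] in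
/-- The product charts of `K × (ℂ² \ {0})` are given by charts of `K`. -/
lemma exists_chart_fst {c : OpenPartialHomeomorph (K × puncturedC2) (E × C2)}
    (hc : c ∈ atlas (E × C2) (K × puncturedC2)) : ∃ c₁ ∈ atlas E K, ∀ y ∈ c.target,
      y.1 ∈ c₁.target ∧ (c.symm y).1 = c₁.symm y.1 ∧ puncturedSnd (c.symm y) = y.2 := by
  obtain ⟨c₁, hc₁, c₂, hc₂, rfl⟩ := hc
  refine ⟨c₁, hc₁, fun y hy => ⟨hy.1, rfl, ?_⟩⟩
  have hne : Nonempty puncturedC2 := ⟨c₂.symm y.2⟩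
  obtain ⟨z, rfl⟩ := TopologicalSpace.Opens.chart_eq' hne hc₂
  exact (chartAt C2 (z : C2)).subtypeRestr_symm_apply _ hy.2

lemma realDeriv_fst (x : K × puncturedC2) :
    realDeriv (E × C2) E Prod.fst x = ContinuousLinearMap.fst ℝ E C2 := by
  have h : HasMFDerivAt (𝓘(ℝ, E).prod 𝓘(ℝ, C2)) 𝓘(ℝ, E) (Prod.fst : K × puncturedC2 → K) x
    (ContinuousLinearMap.fst ℝ E C2) := hasMFDerivAt_fst x
  rw [← modelWithCornersSelf_prod] at h
  exact h.mfderiv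

/-- Charts of the open subset `ℂ² \ {0}` are restrictions of the identity, so in a product chart the
map is a linear projection. -/
lemma realDeriv_puncturedSnd (x : K × puncturedC2) :
    realDeriv (E × C2) C2 puncturedSnd x = ContinuousLinearMap.snd ℝ E C2 := by
  obtain ⟨c₁, -, hc⟩ := exists_chart_fst (chart_mem_atlas (E × C2) x)
  have h2 : writtenInExtChartAt 𝓘(ℝ, E × C2) 𝓘(ℝ, C2) x puncturedSnd =ᶠ[𝓝 (extChartAt 𝓘(ℝ, E × C2) x x)]
      ContinuousLinearMap.snd ℝ E C2 := by
    filter_upwards [(chartAt (E × C2) x).open_target.mem_nhds (mem_chart_target _ x)] with y hy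
    exact (hc y hy).2.2
  exact (mdifferentiableAt_puncturedSnd x).mfderiv.trans (by
    rw [modelWithCornersSelf_coe, Set.range_id, fderivWithin_univ, h2.fderiv_eq, ContinuousLinearMap.fderiv])

end ProductModel

/-! ### The product metric `g + |z|⁻² g_E` and its fundamental form -/

section ProductMetric

open Filter ContinuousLinearMap

variable {E : Type*} [NormedAddCommGroup E] [NormedSpace ℂ E]
  {K : Type*} [TopologicalSpace K] [ChartedSpace E K] [IsManifold 𝓘(ℂ, E) ω K]

namespace HermitianMetric

/-- The product metric `g + |z|⁻² g_E` on `K × (ℂ² \ {0})`, at a point. -/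
noncomputable def hopfBilin (g : HermitianMetric E K) (x : K × puncturedC2) :
    E × C2 →L[ℝ] E × C2 →L[ℝ] ℝ :=
  (g.bilin x.1).bilinearComp (fst ℝ E C2) (fst ℝ E C2) +
    (‖puncturedSnd x‖ ^ 2)⁻¹ • (reInner C2).bilinearComp (snd ℝ E C2) (snd ℝ E C2)

variable (g : HermitianMetric E K)

lemma hopfBilin_apply (x : K × puncturedC2) (v w : E × C2) :
    g.hopfBilin x v w =
      g.bilin x.1 v.1 w.1 + (‖puncturedSnd x‖ ^ 2)⁻¹ * reInner C2 v.2 w.2 := rfl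

/-- Reduces any pull-back of the product metric to the two components of `φ`; smoothness, local form
and invariance are all computed through it. -/
lemma hopfBilin_realDeriv {V N : Type*} [NormedAddCommGroup V] [NormedSpace ℝ V]
    [TopologicalSpace N] [ChartedSpace V N] {φ : N → K × puncturedC2} {y : N}
    (hφ : MDifferentiableAt 𝓘(ℝ, V) 𝓘(ℝ, E × C2) φ y) (v w : V) :
    g.hopfBilin (φ y) (realDeriv V (E × C2) φ y v) (realDeriv V (E × C2) φ y w) =
      g.bilin (φ y).1 (realDeriv V E (Prod.fst ∘ φ) y v) (realDeriv V E (Prod.fst ∘ φ) y w) +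
        (‖puncturedSnd (φ y)‖ ^ 2)⁻¹ * reInner C2 (realDeriv V C2 (puncturedSnd ∘ φ) y v)
          (realDeriv V C2 (puncturedSnd ∘ φ) y w) := by
  rw [realDeriv_comp (mdifferentiableAt_puncturedSnd _) hφ,
    realDeriv_comp (mdifferentiableAt_fst_model _) hφ, realDeriv_fst, realDeriv_puncturedSnd]
  rfl

/-- Both summands are nonnegative, so the unit ball lies in the product of the unit ball of `g` and
the Euclidean ball of radius `‖z‖`. -/
lemma isVonNBounded_hopfBilin (x : K × puncturedC2) :
    Bornology.IsVonNBounded ℝ {v : E × C2 | g.hopfBilin x v v < 1} := by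
  have hx : 0 < ‖puncturedSnd x‖ ^ 2 := by
    have := norm_pos_iff.2 (puncturedSnd_ne_zero x); positivity
  have h0 (v : E) : 0 ≤ g.bilin x.1 v v := by
    by_cases h : v = 0
    · simp [h]
    · exact (g.bilin_pos _ h).le
  rw [NormedSpace.isVonNBounded_iff]
  refine (((NormedSpace.isVonNBounded_iff ℝ).1 (g.isVonNBounded_bilin x.1)).prod
    (Metric.isBounded_ball (x := (0 : C2)) (r := ‖puncturedSnd x‖))).subset ?_
  intro v hv
  have hv' : g.bilin x.1 v.1 v.1 + (‖puncturedSnd x‖ ^ 2)⁻¹ * ‖v.2‖ ^ 2 < 1 := by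
    rw [← reInner_self v.2]; exact hv
  have h1 := h0 v.1
  have h2 : 0 ≤ (‖puncturedSnd x‖ ^ 2)⁻¹ * ‖v.2‖ ^ 2 := by positivity
  refine ⟨show g.bilin x.1 v.1 v.1 < 1 by linarith, ?_⟩
  rw [mem_ball_zero_iff]
  refine lt_of_pow_lt_pow_left₀ 2 (norm_nonneg _) ?_
  have h3 : (‖puncturedSnd x‖ ^ 2)⁻¹ * ‖v.2‖ ^ 2 < 1 := by linarith
  rwa [inv_mul_lt_iff₀ hx, mul_one] at h3

variable [FiniteDimensional ℂ E]

/-- The product metric `g + |z|⁻² g_E` on `K × (ℂ² \ {0})`. -/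
noncomputable def hopfProd : HermitianMetric (E × C2) (K × puncturedC2) where
  inner := g.hopfBilin
  symm x (v w : E × C2) := by
    change g.hopfBilin x v w = g.hopfBilin x w v
    rw [hopfBilin_apply, hopfBilin_apply, g.bilin_symm, reInner_comm]
  pos x (v : E × C2) hv := by
    change 0 < g.hopfBilin x v v
    have hx : 0 < ‖puncturedSnd x‖ := norm_pos_iff.2 (puncturedSnd_ne_zero x)
    rw [hopfBilin_apply, reInner_self]
    by_cases h : v.1 = 0
    · have h2 : v.2 ≠ 0 := fun h2 => hv (Prod.ext h h2)
      have := norm_pos_iff.2 h2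
      rw [h, map_zero, zero_add]
      positivity
    · have := g.bilin_pos x.1 h
      positivity
  isVonNBounded := g.isVonNBounded_hopfBilin
  contMDiff := by
    have := FiniteDimensional.complexToReal E
    refine contMDiff_bilin_of_chartAt g.hopfBilin fun x v w => ?_
    obtain ⟨c₁, hc₁, hc⟩ := exists_chart_fst (chart_mem_atlas (E × C2) x)
    set c := chartAt (E × C2) x
    have hy : c x ∈ c.target := mem_chart_target _ x
    have hcs : ∀ y ∈ c.target, ContMDiffAt (realModel (E × C2)) (realModel (E × C2)) ∞ c.symm y :=
      fun y hy => contMDiffAt_symm_of_mem_maximalAtlas (IsManifold.chart_mem_maximalAtlas x) hy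
    -- In a product chart the metric is the pull-back of `g` under the first projection plus an
    -- explicit function of `y.2`.
    have h1 := g.contDiffAt_pullback (((contMDiff_fst_model (n := ω)).restrictScalars_real.of_le
      le_top).contMDiffAt.comp _ (hcs _ hy)) v w
    have h2 : ContDiffAt ℝ ∞ (fun y : E × C2 => (‖y.2‖ ^ 2)⁻¹ * reInner C2 v.2 w.2) (c x) := by
      refine ContDiffAt.mul ?_ contDiffAt_const
      refine (contDiffAt_inv_norm_sq ?_).comp (c x) contDiffAt_snd
      rw [← (hc _ hy).2.2]
      exact puncturedSnd_ne_zero _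
    refine (h1.add h2).congr_of_eventuallyEq ?_
    filter_upwards [c.open_target.mem_nhds hy] with y hy
    have h3 : puncturedSnd ∘ c.symm =ᶠ[𝓝 y] snd ℝ E C2 := by
      filter_upwards [c.open_target.mem_nhds hy] with y hy
      exact (hc y hy).2.2
    rw [g.hopfBilin_realDeriv ((hcs y hy).mdifferentiableAt (by simp)), h3.realDeriv_eq,
      realDeriv_eq_fderiv, ContinuousLinearMap.fderiv, (hc y hy).2.2]
    rfl
  hermitian x (v w : E × C2) := by
    change g.hopfBilin x (Complex.I • v) (Complex.I • w) = g.hopfBilin x v w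
    simp only [hopfBilin_apply, Prod.smul_fst, Prod.smul_snd, g.bilin_I_smul,
      reInner_I_smul_I_smul]

lemma bilin_hopfProd (x : K × puncturedC2) : g.hopfProd.bilin x = g.hopfBilin x := rfl

/-- In a product chart, the fundamental form of the product metric is the sum of the fundamental
forms of the factors. -/
lemma localForm_hopfProd {c : OpenPartialHomeomorph (K × puncturedC2) (E × C2)}
    (hc : c ∈ atlas (E × C2) (K × puncturedC2)) : ∃ c₁ ∈ atlas E K, ∀ y ∈ c.target,
      y.1 ∈ c₁.target ∧ y.2 ≠ 0 ∧ g.hopfProd.localForm c y =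
        (g.localForm c₁ y.1).compContinuousLinearMap (fst ℝ E C2) +
          (hopfForm y.2).compContinuousLinearMap (snd ℝ E C2) := by
  obtain ⟨c₁, hc₁, h⟩ := exists_chart_fst hc
  refine ⟨c₁, hc₁, fun y hy => ⟨(h y hy).1, ?_, ?_⟩⟩
  · rw [← (h y hy).2.2]
    exact puncturedSnd_ne_zero _
  have hcs : MDifferentiableAt (realModel (E × C2)) (realModel (E × C2)) c.symm y :=
    mdifferentiableAt_atlas_symm hc hy
  have h1 : Prod.fst ∘ c.symm =ᶠ[𝓝 y] c₁.symm ∘ fst ℝ E C2 := by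
    filter_upwards [c.open_target.mem_nhds hy] with y hy
    exact (h y hy).2.1
  have h2 : puncturedSnd ∘ c.symm =ᶠ[𝓝 y] snd ℝ E C2 := by
    filter_upwards [c.open_target.mem_nhds hy] with y hy
    exact (h y hy).2.2
  have hcs' : MDifferentiableAt 𝓘(ℂ, E × C2) 𝓘(ℂ, E × C2) c.symm y :=
    mdifferentiableAt_atlas_symm hc hy
  have h3 : MDifferentiableAt (realModel E) (realModel E) c₁.symm y.1 :=
    mdifferentiableAt_atlas_symm hc₁ (h y hy).1
  have h3' : MDifferentiableAt 𝓘(ℂ, E) 𝓘(ℂ, E) c₁.symm y.1 :=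
    mdifferentiableAt_atlas_symm hc₁ (h y hy).1
  have h4 : realDeriv (E × C2) E (c₁.symm ∘ fst ℝ E C2) y =
      (realDeriv E E c₁.symm y.1).comp (fst ℝ E C2) := by
    have := realDeriv_comp (f := fst ℝ E C2) h3 (fst ℝ E C2).mdifferentiableAt
    rwa [realDeriv_eq_fderiv, ContinuousLinearMap.fderiv] at this
  ext v
  rw [localForm_apply, ← realDeriv_I_smul hcs', bilin_hopfProd, hopfBilin_realDeriv g hcs,
    h1.realDeriv_eq, h2.realDeriv_eq, h4,
    realDeriv_eq_fderiv, ContinuousLinearMap.fderiv, (h y hy).2.1, (h y hy).2.2]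
  change g.bilin (c₁.symm y.1) (realDeriv E E c₁.symm y.1 (Complex.I • (v 0).1))
      (realDeriv E E c₁.symm y.1 (v 1).1) + _ = g.bilin (c₁.symm y.1)
      (Complex.I • realDeriv E E c₁.symm y.1 (v 0).1) (realDeriv E E c₁.symm y.1 (v 1).1) + _
  rw [realDeriv_I_smul h3']
  rfl

end HermitianMetric

end ProductMetric

lemma DifferentiableAt.compContinuousLinearMap_clm {V W : Type*} [NormedAddCommGroup V]
    [NormedSpace ℝ V] [NormedAddCommGroup W] [NormedSpace ℝ W] {k : ℕ} {α : W → W [⋀^Fin k]→L[ℝ] ℝ}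
    (L : V →L[ℝ] W) {y : V} (h : DifferentiableAt ℝ α (L y)) :
    DifferentiableAt ℝ (fun z => (α (L z)).compContinuousLinearMap L) y := by
  have h1 : DifferentiableAt ℝ (α ∘ L) y := h.comp y L.differentiableAt
  exact (ContinuousAlternatingMap.compContinuousLinearMapCLM L).differentiableAt.comp y h1

lemma extDeriv_pullback_clm {V W : Type*} [NormedAddCommGroup V]
    [NormedSpace ℝ V] [NormedAddCommGroup W] [NormedSpace ℝ W] {k : ℕ} {α : W → W [⋀^Fin k]→L[ℝ] ℝ}
    (L : V →L[ℝ] W) {y : V} (h : DifferentiableAt ℝ α (L y)) :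
    extDeriv (fun z => (α (L z)).compContinuousLinearMap L) y =
      (extDeriv α (L y)).compContinuousLinearMap L := by
  simpa using extDeriv_pullback h L.contDiff.contDiffAt le_rfl

/-! ### The product metric is pluriclosed -/

section SKT

open Filter ContinuousLinearMap

variable {E : Type*} [NormedAddCommGroup E] [NormedSpace ℂ E] [FiniteDimensional ℂ E]
  {K : Type*} [TopologicalSpace K] [ChartedSpace E K] [IsManifold 𝓘(ℂ, E) ω K]
  {M : Type*} [TopologicalSpace M] [ChartedSpace (E × C2) M] [IsManifold 𝓘(ℂ, E × C2) ω M]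

/-- A metric that pulls back to the product of a Kähler metric and `|z|⁻² g_E` is pluriclosed. -/
theorem HermitianMetric.isSKT_of_pullback_eq_hopfProd (h : HermitianMetric (E × C2) M)
    {g : HermitianMetric E K} (hg : g.IsKahler) {π : K × puncturedC2 → M}
    (hπ : IsLocalDiffeomorph 𝓘(ℂ, E × C2) 𝓘(ℂ, E × C2) ω π) (hc : ChartsDescend (E × C2) π)
    (hG : ∀ (x : K × puncturedC2) (v w : E × C2), h.bilin (π x) (realDeriv (E × C2) (E × C2) π x v)
      (realDeriv (E × C2) (E × C2) π x w) = g.hopfProd.bilin x v w) : h.IsSKT := by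
  intro e he y hy
  obtain ⟨s, c, hcN, hs, rfl⟩ := hc e he
  obtain ⟨c₁, hc₁, H⟩ := g.localForm_hopfProd hcN
  -- `d` commutes with the two linear projections, and the summand from `K` vanishes because `g` is
  -- Kähler.
  have hd : ∀ z ∈ (s.trans c).target, extDeriv (h.localForm (s.trans c)) z =
      (extDeriv hopfForm (snd ℝ E C2 z)).compContinuousLinearMap (snd ℝ E C2) := by
    intro z hz
    have h1 : h.localForm (s.trans c) =ᶠ[𝓝 z]
        fun z => (g.localForm c₁ (fst ℝ E C2 z)).compContinuousLinearMap (fst ℝ E C2) +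
          (hopfForm (snd ℝ E C2 z)).compContinuousLinearMap (snd ℝ E C2) := by
      filter_upwards [(s.trans c).open_target.mem_nhds hz] with z hz
      rw [h.localForm_trans g.hopfProd hπ hG s hs hcN hz.1]
      exact (H z hz.1).2.2
    have h2 : DifferentiableAt ℝ (g.localForm c₁) (fst ℝ E C2 z) :=
      (g.contDiffAt_localForm hc₁ (H z hz.1).1).differentiableAt (by simp)
    have h3 : DifferentiableAt ℝ hopfForm (snd ℝ E C2 z) :=
      (contDiffAt_hopfForm (H z hz.1).2.1 (n := 1)).differentiableAt (by simp)
    rw [h1.extDeriv_eq, extDeriv_fun_add (h2.compContinuousLinearMap_clm _)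
      (h3.compContinuousLinearMap_clm _), extDeriv_pullback_clm _ h2, extDeriv_pullback_clm _ h3,
      hg c₁ hc₁ (fst ℝ E C2 z) (H z hz.1).1]
    ext v
    simp
  -- Multiplication by `i` commutes with the projection to `ℂ²`, so `dᶜ Ω` is itself a pull-back
  -- from `ℂ²`.
  have hdc : h.localDc (s.trans c) =ᶠ[𝓝 y] (-1 : ℝ) • fun z =>
      ((extDeriv hopfForm (snd ℝ E C2 z)).compContinuousLinearMap
        (mulI C2)).compContinuousLinearMap (snd ℝ E C2) := by
    filter_upwards [(s.trans c).open_target.mem_nhds hy] with z hz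
    rw [localDc, hd z hz]
    ext v
    simp
    rfl
  have h4 := (contDiffAt_extDeriv_hopfForm (H y hy.1).2.1 (n := 1)).differentiableAt (by simp)
  rw [hdc.extDeriv_eq, extDeriv_smul,
    extDeriv_pullback_clm (α := fun z => (extDeriv hopfForm z).compContinuousLinearMap (mulI C2))
      (snd ℝ E C2) h4, show snd ℝ E C2 y = y.2 from rfl, extDeriv_dc_hopfForm (H y hy.1).2.1]
  ext v
  simp

end SKT

/-! ### Deck transformations of quotients by group actions -/

section Actions

open Filter

variable {𝕜 : Type*} [NontriviallyNormedField 𝕜] {E H : Type*} [NormedAddCommGroup E]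
  [NormedSpace 𝕜 E] [TopologicalSpace H] {I : ModelWithCorners 𝕜 E H} {n : WithTop ℕ∞}
  {N M P : Type*} [TopologicalSpace N] [ChartedSpace H N]

lemma hasLocalDeckTransformations_quotientMk {G : Type*} [AddGroup G] [AddAction G N]
    (h : ∀ a : G, ContMDiff I I n fun x : N => a +ᵥ x) :
    HasLocalDeckTransformations I n (Quotient.mk (AddAction.orbitRel G N)) := by
  intro x x' hx
  obtain ⟨a, ha⟩ : x' ∈ AddAction.orbit G x := Quotient.exact hx.symm
  refine ⟨fun x => a +ᵥ x, h a x, ha, Eventually.of_forall fun y => ?_⟩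
  exact Quotient.sound ⟨a, rfl⟩

lemma HasLocalDeckTransformations.comp_injective {f : N → M}
    (hf : HasLocalDeckTransformations I n f) {g : M → P} (hg : Function.Injective g) :
    HasLocalDeckTransformations I n (g ∘ f) := by
  intro x x' hx
  obtain ⟨σ, hσ, hσx, hσf⟩ := hf x x' (hg hx)
  exact ⟨σ, hσ, hσx, hσf.fun_comp g⟩

end Actions

/-! ### Powers of a holomorphic isometry -/

section Isometries

variable {E : Type*} [NormedAddCommGroup E] [NormedSpace ℂ E]
  {K : Type*} [TopologicalSpace K] [ChartedSpace E K] [IsManifold 𝓘(ℂ, E) ω K]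

omit [IsManifold 𝓘(ℂ, E) ω K] in
lemma ContMDiff.mdifferentiableAt_real {φ : K → K} (hφ : ContMDiff 𝓘(ℂ, E) 𝓘(ℂ, E) ω φ) (x : K) :
    MDifferentiableAt (realModel E) (realModel E) φ x :=
  hφ.restrictScalars_real.mdifferentiableAt (by simp)

/-- The group of holomorphic isometries of a Hermitian manifold. -/
def HermitianMetric.isometryGroup (g : HermitianMetric E K) : Subgroup (K ≃ₜ K) where
  carrier := {φ | ContMDiff 𝓘(ℂ, E) 𝓘(ℂ, E) ω φ ∧ ContMDiff 𝓘(ℂ, E) 𝓘(ℂ, E) ω φ.symm ∧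
    ∀ (x : K) (v w : E), g.bilin (φ x) (realDeriv E E φ x v) (realDeriv E E φ x w) = g.bilin x v w}
  one_mem' := by
    refine ⟨contMDiff_id, contMDiff_id, fun x v w => ?_⟩
    have h : realDeriv E E (1 : K ≃ₜ K) x = ContinuousLinearMap.id ℝ E :=
      mfderiv_id (I := 𝓘(ℝ, E))
    rw [h]
    rfl
  mul_mem' := by
    rintro φ χ ⟨h1, h2, h3⟩ ⟨k1, k2, k3⟩
    refine ⟨h1.comp k1, k2.comp h2, fun x v w => ?_⟩
    have h : realDeriv E E (φ * χ : K ≃ₜ K) x = _ :=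
      realDeriv_comp (g := φ) (f := χ) (h1.mdifferentiableAt_real (χ x)) (k1.mdifferentiableAt_real x)
    rw [h, ← k3 x, ← h3 (χ x)]
    rfl
  inv_mem' := by
    rintro φ ⟨h1, h2, h3⟩
    refine ⟨h2, h1, fun x v w => ?_⟩
    -- By the chain rule for `φ ∘ φ.symm = id`, the vectors are images under `dφ`, and the
    -- invariance under `φ` can be read backwards.
    have h := realDeriv_comp (h1.mdifferentiableAt_real (φ.symm x)) (h2.mdifferentiableAt_real x)
    have h' : realDeriv E E (φ ∘ φ.symm) x = ContinuousLinearMap.id ℝ E := by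
      rw [φ.self_comp_symm]
      exact mfderiv_id (I := 𝓘(ℝ, E))
    rw [h'] at h
    have h4 (v : E) : realDeriv E E φ (φ.symm x) (realDeriv E E φ.symm x v) = v :=
      (DFunLike.congr_fun h v).symm
    change g.bilin (φ.symm x) (realDeriv E E φ.symm x v) (realDeriv E E φ.symm x w) = _
    rw [← h3, h4, h4, φ.apply_symm_apply]

end Isometries

/-! ### Polar coordinates and the homeomorphism `Φ` -/

section Homeomorphism

variable {K : Type*} [TopologicalSpace K] (φ : K ≃ₜ K)

/-- The polar coordinates `((p, q), t) ↦ (p, 2ᵗ q)` of `K × (ℂ² \ {0})`. -/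
noncomputable def polarHomeomorph :
    MappingTorusCover (φ.prodCongr (Homeomorph.refl S3)) ≃ₜ HopfCover φ where
  toFun x := (x.1.1, scalePunctured ((2 : ℝ) ^ x.2) (by positivity) x.1.2
    (ne_zero_of_mem_unit_sphere x.1.2))
  invFun y := ((y.1, ⟨‖(y.2 : C2)‖⁻¹ • (y.2 : C2), by
    have := norm_ne_zero_iff.2 y.2.2
    rw [mem_sphere_zero_iff_norm, norm_smul, norm_inv, norm_norm, inv_mul_cancel₀ this]⟩),
    Real.logb 2 ‖(y.2 : C2)‖)
  left_inv := by
    rintro ⟨⟨p, q⟩, t⟩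
    have h : ‖(2 : ℝ) ^ t • (q : C2)‖ = 2 ^ t := by
      rw [norm_smul, norm_eq_of_mem_sphere, mul_one, Real.norm_of_nonneg (by positivity)]
    refine Prod.ext (Prod.ext rfl (Subtype.ext ?_)) ?_
    · change ‖(2 : ℝ) ^ t • (q : C2)‖⁻¹ • (2 : ℝ) ^ t • (q : C2) = q
      rw [h, smul_smul, inv_mul_cancel₀ (by positivity), one_smul]
    · change Real.logb 2 ‖(2 : ℝ) ^ t • (q : C2)‖ = t
      rw [h, Real.logb_rpow two_pos (by norm_num)]
  right_inv := by
    rintro ⟨p, z⟩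
    have h : 0 < ‖(z : C2)‖ := norm_pos_iff.2 z.2
    refine Prod.ext rfl (Subtype.ext ?_)
    change (2 : ℝ) ^ Real.logb 2 ‖(z : C2)‖ • ‖(z : C2)‖⁻¹ • (z : C2) = z
    rw [Real.rpow_logb two_pos (by norm_num) h, smul_smul, mul_inv_cancel₀ h.ne', one_smul]
  continuous_toFun := by
    refine (continuous_fst.comp continuous_fst).prodMk (Continuous.subtype_mk ?_ _)
    exact ((Real.continuous_const_rpow two_ne_zero).comp continuous_snd).smul
      (continuous_subtype_val.comp (continuous_snd.comp continuous_fst))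
  continuous_invFun := by
    have h : Continuous fun y : HopfCover φ => (y.2 : C2) :=
      continuous_subtype_val.comp continuous_snd
    exact (continuous_fst.prodMk
      (((h.norm.inv₀ fun y => norm_ne_zero_iff.2 y.2.2).smul h).subtype_mk _)).prodMk
      (HopfCover.continuous_logb φ)

/-- The assignment `χ ↦ χ × id` is a group homomorphism, hence commutes with integer powers. -/
lemma prodCongr_refl_zpow_apply (n : ℤ) (y : K × S3) :
    ((φ.prodCongr (Homeomorph.refl S3)) ^ n) y = ((φ ^ n) y.1, y.2) := by
  let F : (K ≃ₜ K) →* (K × S3 ≃ₜ K × S3) :=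
    { toFun χ := χ.prodCongr (Homeomorph.refl S3)
      map_one' := rfl
      map_mul' _ _ := rfl }
  exact DFunLike.congr_fun (map_zpow F φ n).symm y

lemma polarHomeomorph_vadd (n : ℤ) (x : MappingTorusCover (φ.prodCongr (Homeomorph.refl S3))) :
    polarHomeomorph φ (n +ᵥ x) = n +ᵥ polarHomeomorph φ x := by
  refine Prod.ext ?_ (Subtype.ext ?_)
  · change (((φ.prodCongr (Homeomorph.refl S3)) ^ n) x.1).1 = (φ ^ n) x.1.1
    rw [prodCongr_refl_zpow_apply]
  · change (2 : ℝ) ^ (x.2 + n) • (((φ.prodCongr (Homeomorph.refl S3)) ^ n) x.1).2.1 =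
      (2 : ℝ) ^ n • (2 : ℝ) ^ x.2 • (x.1.2 : C2)
    rw [prodCongr_refl_zpow_apply, smul_smul, Real.rpow_add two_pos, Real.rpow_intCast, mul_comm]

/-- The homeomorphism `[p, q, t] ↦ [p, 2ᵗ q]` from the mapping torus to the quotient of
`K × (ℂ² \ {0})`. -/
noncomputable def mappingTorusHomeomorph : SphereMappingTorus φ ≃ₜ HopfQuotient φ where
  toEquiv := Quotient.congr (polarHomeomorph φ).toEquiv fun x y => by
    change x ∈ AddAction.orbit ℤ y ↔ polarHomeomorph φ x ∈ AddAction.orbit ℤ (polarHomeomorph φ y)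
    refine exists_congr fun n => ?_
    change n +ᵥ y = x ↔ n +ᵥ polarHomeomorph φ y = polarHomeomorph φ x
    rw [← polarHomeomorph_vadd, (polarHomeomorph φ).injective.eq_iff]
  continuous_toFun := isQuotientMap_quotient_mk'.continuous_iff.2
    (continuous_quotient_mk'.comp (polarHomeomorph φ).continuous)
  continuous_invFun := isQuotientMap_quotient_mk'.continuous_iff.2
    (continuous_quotient_mk'.comp (polarHomeomorph φ).symm.continuous)

end Homeomorphism

lemma ContMDiff.of_subtypeVal_comp {𝕜 E E' H H' M M' : Type*} [NontriviallyNormedField 𝕜]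
    [NormedAddCommGroup E] [NormedSpace 𝕜 E] [NormedAddCommGroup E'] [NormedSpace 𝕜 E']
    [TopologicalSpace H] [TopologicalSpace H'] {I : ModelWithCorners 𝕜 E H}
    {I' : ModelWithCorners 𝕜 E' H'} [TopologicalSpace M] [ChartedSpace H M] [TopologicalSpace M']
    [ChartedSpace H' M'] {U : TopologicalSpace.Opens M'} {f : M → U} {n : WithTop ℕ∞}
    (h : ContMDiff I I' n fun x => (f x : M')) : ContMDiff I I' n f := fun x =>
  (ChartedSpace.liftPropWithinAt_subtypeVal_comp_iff ..).1 (h x)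

lemma IsLocalDiffeomorph.of_le {𝕜 E E' H H' M M' : Type*} [NontriviallyNormedField 𝕜]
    [NormedAddCommGroup E] [NormedSpace 𝕜 E] [NormedAddCommGroup E'] [NormedSpace 𝕜 E']
    [TopologicalSpace H] [TopologicalSpace H'] {I : ModelWithCorners 𝕜 E H}
    {I' : ModelWithCorners 𝕜 E' H'} [TopologicalSpace M] [ChartedSpace H M] [TopologicalSpace M']
    [ChartedSpace H' M'] {f : M → M'} {m n : WithTop ℕ∞} (h : IsLocalDiffeomorph I I' n f)
    (hmn : m ≤ n) : IsLocalDiffeomorph I I' m f := fun x =>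
  let ⟨Φ, hx, hΦ⟩ := h x
  ⟨⟨Φ.toPartialEquiv, Φ.open_source, Φ.open_target, Φ.contMDiffOn_toFun.of_le hmn,
    Φ.contMDiffOn_invFun.of_le hmn⟩, hx, hΦ⟩

/-! ### Polar coordinates are a diffeomorphism -/

section Polar

variable {E : Type*} [NormedAddCommGroup E] [NormedSpace ℂ E]
  {K : Type*} [TopologicalSpace K] [ChartedSpace E K] (φ : K ≃ₜ K)

lemma contMDiff_prod_real_model_iff {H' E' P : Type*} [NormedAddCommGroup E'] [NormedSpace ℝ E']
    [TopologicalSpace H'] {J : ModelWithCorners ℝ E' H'} [TopologicalSpace P] [ChartedSpace H' P]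
    {n : WithTop ℕ∞} {f : P → K × puncturedC2} :
    ContMDiff J (realModel (E × C2)) n f ↔
      ContMDiff J ((realModel E).prod (realModel C2)) n f := by
  have h : realModel (E × C2) = (realModel E).prod (realModel C2) := modelWithCornersSelf_prod
  rw [h]

lemma contMDiff_polarHomeomorph {n : WithTop ℕ∞} :
    ContMDiff (((realModel E).prod (𝓡 3)).prod 𝓘(ℝ, ℝ)) (realModel (E × C2)) n
      (M := (K × S3) × ℝ) (M' := K × puncturedC2) (polarHomeomorph φ) := by
  refine contMDiff_prod_real_model_iff.2 ?_
  refine (contMDiff_fst.comp contMDiff_fst).prodMk (ContMDiff.of_subtypeVal_comp ?_)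
  have h1 : ContDiff ℝ n fun t : ℝ => (2 : ℝ) ^ t :=
    contDiff_const.rpow contDiff_id fun _ => two_ne_zero
  exact (h1.contMDiff.comp contMDiff_snd).smul
    (contMDiff_coe_sphere.comp (contMDiff_snd.comp contMDiff_fst))

lemma contMDiff_polarHomeomorph_symm [IsManifold 𝓘(ℂ, E) ω K] :
    ContMDiff (realModel (E × C2)) (((realModel E).prod (𝓡 3)).prod 𝓘(ℝ, ℝ)) ∞
      (M := K × puncturedC2) (M' := (K × S3) × ℝ) (polarHomeomorph φ).symm := by
  have h0 : ContMDiff (realModel (E × C2)) (realModel C2) ∞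
      (puncturedSnd : K × puncturedC2 → C2) :=
    contMDiff_puncturedSnd.restrictScalars_real
  have h1 : ContMDiff (realModel (E × C2)) 𝓘(ℝ, ℝ) ∞
      fun x : K × puncturedC2 => ‖puncturedSnd x‖ := fun x =>
    ((contDiffAt_norm ℝ (puncturedSnd_ne_zero x)).contMDiffAt).comp x (h0 x)
  have h2 (x : K × puncturedC2) : ‖puncturedSnd x‖ ≠ 0 := norm_ne_zero_iff.2 (puncturedSnd_ne_zero x)
  have h3 : ContMDiff (realModel (E × C2)) 𝓘(ℝ, ℝ) ∞
      fun x : K × puncturedC2 => ‖puncturedSnd x‖⁻¹ := fun x =>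
    (contDiffAt_inv ℝ (h2 x)).contMDiffAt.comp x (h1 x)
  refine ((contMDiff_fst_model.restrictScalars_real).prodMk
    (ContMDiff.codRestrict_sphere (h3.smul h0) _)).prodMk fun x => ?_
  exact ((Real.contDiffAt_log.2 (h2 x)).div_const (Real.log 2)).contMDiffAt.comp x (h1 x)

end Polar

/-! ### Smoothness of the two actions of `ℤ` -/

section Deck

variable {E : Type*} [NormedAddCommGroup E] [NormedSpace ℂ E]
  {K : Type*} [TopologicalSpace K] [ChartedSpace E K] {φ : K ≃ₜ K}

lemma contMDiff_hopfCover_vadd {n : WithTop ℕ∞} (a : ℤ) (hφ : ContMDiff 𝓘(ℂ, E) 𝓘(ℂ, E) n ⇑(φ ^ a)) :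
    ContMDiff (𝓘(ℂ, E).prod 𝓘(ℂ, C2)) (𝓘(ℂ, E).prod 𝓘(ℂ, C2)) n
      fun x : HopfCover φ => a +ᵥ x := by
  have h : ContMDiff (𝓘(ℂ, E).prod 𝓘(ℂ, C2)) 𝓘(ℂ, C2) n
      fun x : K × puncturedC2 => (2 : ℝ) ^ a • (x.2 : C2) :=
    (contDiff_const_smul ((2 : ℝ) ^ a)).contMDiff.comp (contMDiff_subtype_val.comp contMDiff_snd)
  exact (hφ.comp contMDiff_fst).prodMk (ContMDiff.of_subtypeVal_comp h)

lemma contMDiff_mappingTorusCover_vadd (a : ℤ) {n : WithTop ℕ∞}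
    (hφ : ContMDiff (realModel E) (realModel E) n ⇑(φ ^ a)) :
    ContMDiff (((realModel E).prod (𝓡 3)).prod 𝓘(ℝ, ℝ)) (((realModel E).prod (𝓡 3)).prod 𝓘(ℝ, ℝ)) n
      fun x : MappingTorusCover (φ.prodCongr (Homeomorph.refl S3)) => a +ᵥ x := by
  have h1 : ContMDiff (((realModel E).prod (𝓡 3)).prod 𝓘(ℝ, ℝ)) ((realModel E).prod (𝓡 3)) n
      fun x : (K × S3) × ℝ => ((φ.prodCongr (Homeomorph.refl S3)) ^ a) x.1 := by
    simp only [prodCongr_refl_zpow_apply]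
    exact (hφ.comp (contMDiff_fst.comp contMDiff_fst)).prodMk (contMDiff_snd.comp contMDiff_fst)
  exact h1.prodMk ((contDiff_id.add contDiff_const).contMDiff.comp contMDiff_snd)

end Deck

/-! ### Smooth and complex structures on the quotients -/

section Quotients

variable {E : Type*} [NormedAddCommGroup E] [NormedSpace ℂ E]
  {K : Type*} [TopologicalSpace K] [ChartedSpace E K] [T2Space K] [LocallyCompactSpace K]
  (φ : K ≃ₜ K)

/-- The model of the mapping torus of a self-map of `K × S³`. -/
local notation "Jr" => ModelWithCorners.prod (ModelWithCorners.prod (realModel E) (𝓡 3)) 𝓘(ℝ, ℝ)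

/-- The model of the quotient of `K × (ℂ² \ {0})`. -/
local notation "Jc" => ModelWithCorners.prod 𝓘(ℂ, E) 𝓘(ℂ, C2)

instance [IsManifold 𝓘(ℂ, E) ω K] : IsManifold (𝓘(ℂ, E).prod 𝓘(ℂ, C2)) ω (HopfCover φ) :=
  inferInstanceAs (IsManifold (𝓘(ℂ, E).prod 𝓘(ℂ, C2)) ω (K × puncturedC2))

instance [IsManifold 𝓘(ℂ, E) ω K] : IsManifold (((realModel E).prod (𝓡 3)).prod 𝓘(ℝ, ℝ)) ∞
    (MappingTorusCover (φ.prodCongr (Homeomorph.refl S3))) :=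
  inferInstanceAs (IsManifold (((realModel E).prod (𝓡 3)).prod 𝓘(ℝ, ℝ)) ∞ ((K × S3) × ℝ))

omit [ChartedSpace E K] in
lemma isLocalHomeomorph_hopfQuotient_mk : IsLocalHomeomorph (HopfQuotient.mk φ) :=
  (isAddQuotientCoveringMap_quotientMk_of_properlyDiscontinuousVAdd (G := ℤ)
    (E := HopfCover φ)).isCoveringMap.isLocalHomeomorph

omit [ChartedSpace E K] in
lemma isLocalHomeomorph_mappingTorus_mk :
    IsLocalHomeomorph (Quotient.mk (AddAction.orbitRel ℤ
      (MappingTorusCover (φ.prodCongr (Homeomorph.refl S3))))) :=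
  isAddQuotientCoveringMap_quotientMk_of_properlyDiscontinuousVAdd.isCoveringMap.isLocalHomeomorph

-- The quotient atlas is by definition the one that the covering projection induces through its
-- local inverses.
omit [NormedSpace ℂ E] in
lemma chartsDescend_hopfQuotient_mk : ChartsDescend (ModelProd E C2)
    (Quotient.mk (AddAction.orbitRel ℤ (HopfCover φ))) :=
  (isLocalHomeomorph_hopfQuotient_mk φ).chartsDescend_chartedSpace Quotient.mk_surjective

omit [NormedSpace ℂ E] in
lemma chartsDescend_mappingTorus_mk :
    ChartsDescend (ModelProd (ModelProd E (EuclideanSpace ℝ (Fin 3))) ℝ)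
      (Quotient.mk (AddAction.orbitRel ℤ
        (MappingTorusCover (φ.prodCongr (Homeomorph.refl S3))))) :=
  (isLocalHomeomorph_mappingTorus_mk φ).chartsDescend_chartedSpace Quotient.mk_surjective

/-- The projection of `K × (ℂ² \ {0})` onto the mapping torus of `(φ, Id)`. -/
noncomputable def mappingTorusProj (x : K × puncturedC2) : SphereMappingTorus φ :=
  (mappingTorusHomeomorph φ).symm (HopfQuotient.mk φ x)

omit [ChartedSpace E K] in
lemma isLocalHomeomorph_mappingTorusProj : IsLocalHomeomorph (mappingTorusProj φ) :=
  (mappingTorusHomeomorph φ).symm.isLocalHomeomorph.comp (isLocalHomeomorph_hopfQuotient_mk φ)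

omit [ChartedSpace E K] [T2Space K] [LocallyCompactSpace K] in
lemma surjective_mappingTorusProj : Function.Surjective (mappingTorusProj φ) :=
  (mappingTorusHomeomorph φ).symm.surjective.comp Quotient.mk_surjective

/-- The complex charts of the mapping torus of `(φ, Id)`. -/
noncomputable abbrev mappingTorusComplexCharts : ChartedSpace (E × C2) (SphereMappingTorus φ) :=
  (isLocalHomeomorph_mappingTorusProj φ).chartedSpace (surjective_mappingTorusProj φ)

attribute [local instance] mappingTorusComplexCharts

omit [NormedSpace ℂ E] in
lemma chartsDescend_mappingTorusProj : ChartsDescend (E × C2) (mappingTorusProj φ) :=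
  (isLocalHomeomorph_mappingTorusProj φ).chartsDescend_chartedSpace (surjective_mappingTorusProj φ)

variable {φ} [IsManifold 𝓘(ℂ, E) ω K] (hφ : ∀ a : ℤ, ContMDiff 𝓘(ℂ, E) 𝓘(ℂ, E) ω ⇑(φ ^ a))

include hφ

omit [T2Space K] [LocallyCompactSpace K] [IsManifold 𝓘(ℂ, E) ω K] in
lemma deck_hopfQuotient_mk : HasLocalDeckTransformations Jc ω
    (Quotient.mk (AddAction.orbitRel ℤ (HopfCover φ))) :=
  hasLocalDeckTransformations_quotientMk fun a => contMDiff_hopfCover_vadd a (hφ a)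

omit [T2Space K] [LocallyCompactSpace K] [IsManifold 𝓘(ℂ, E) ω K] in
lemma deck_mappingTorus_mk : HasLocalDeckTransformations Jr ∞ (Quotient.mk (AddAction.orbitRel ℤ
    (MappingTorusCover (φ.prodCongr (Homeomorph.refl S3))))) :=
  hasLocalDeckTransformations_quotientMk fun a =>
    contMDiff_mappingTorusCover_vadd a ((hφ a).restrictScalars_real.of_le le_top)

omit [T2Space K] [LocallyCompactSpace K] [IsManifold 𝓘(ℂ, E) ω K] in
lemma deck_mappingTorusProj : HasLocalDeckTransformations 𝓘(ℂ, E × C2) ω (mappingTorusProj φ) := by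
  have h : HasLocalDeckTransformations 𝓘(ℂ, E × C2) ω
      (N := K × puncturedC2) (HopfQuotient.mk φ) := by
    have h1 := deck_hopfQuotient_mk hφ
    rw [modelWithCornersSelf_prod]
    exact h1
  -- Following the projection by a bijection does not change its fibres, so the deck transformations
  -- of `X` serve again.
  exact h.comp_injective (mappingTorusHomeomorph φ).symm.injective

theorem isManifold_hopfQuotient : IsManifold Jc ω (HopfQuotient φ) :=
  (deck_hopfQuotient_mk hφ).isManifold _ _ (chartsDescend_hopfQuotient_mk φ)

theorem isManifold_sphereMappingTorus : IsManifold Jr ∞ (SphereMappingTorus φ) :=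
  (deck_mappingTorus_mk hφ).isManifold _ _ (chartsDescend_mappingTorus_mk φ)

theorem isManifold_complex_sphereMappingTorus :
    IsManifold 𝓘(ℂ, E × C2) ω (SphereMappingTorus φ) :=
  (deck_mappingTorusProj hφ).isManifold _ _ (chartsDescend_mappingTorusProj φ)

theorem isLocalDiffeomorph_mappingTorusProj :
    IsLocalDiffeomorph 𝓘(ℂ, E × C2) 𝓘(ℂ, E × C2) ω (mappingTorusProj φ) :=
  have := isManifold_complex_sphereMappingTorus hφ
  (deck_mappingTorusProj hφ).isLocalDiffeomorph (isLocalHomeomorph_mappingTorusProj φ)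
    (chartsDescend_mappingTorusProj φ)

theorem isLocalDiffeomorph_hopfQuotient_mk :
    IsLocalDiffeomorph Jc Jc ω (Quotient.mk (AddAction.orbitRel ℤ (HopfCover φ))) :=
  have := isManifold_hopfQuotient hφ
  (deck_hopfQuotient_mk hφ).isLocalDiffeomorph (isLocalHomeomorph_hopfQuotient_mk φ)
    (chartsDescend_hopfQuotient_mk φ)

theorem isLocalDiffeomorph_mappingTorus_mk :
    IsLocalDiffeomorph Jr Jr ∞ (Quotient.mk (AddAction.orbitRel ℤ
      (MappingTorusCover (φ.prodCongr (Homeomorph.refl S3))))) :=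
  have := isManifold_sphereMappingTorus hφ
  (deck_mappingTorus_mk hφ).isLocalDiffeomorph (isLocalHomeomorph_mappingTorus_mk φ)
    (chartsDescend_mappingTorus_mk φ)

/-- Smoothness may be tested after composition with `mappingTorusProj`, and there the identity
becomes inverse polar coordinates followed by the quotient map of `K × S³ × ℝ`. This and the
converse say that the complex atlas induces the given smooth structure. -/
theorem contMDiff_id_sphereMappingTorus : ContMDiff (realModel (E × C2)) Jr ∞
    (id : SphereMappingTorus φ → SphereMappingTorus φ) := by
  have h1 := (isLocalDiffeomorph_mappingTorusProj hφ).restrictScalars_real.of_le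
    (show (∞ : WithTop ℕ∞) ≤ ω from le_top)
  refine h1.contMDiff_of_comp (surjective_mappingTorusProj φ) ?_
  exact (isLocalDiffeomorph_mappingTorus_mk hφ).contMDiff.comp (contMDiff_polarHomeomorph_symm φ)

theorem contMDiff_id_sphereMappingTorus_symm : ContMDiff Jr (realModel (E × C2)) ∞
    (id : SphereMappingTorus φ → SphereMappingTorus φ) := by
  refine (isLocalDiffeomorph_mappingTorus_mk hφ).contMDiff_of_comp Quotient.mk_surjective ?_
  have h1 := (isLocalDiffeomorph_mappingTorusProj hφ).contMDiff.restrictScalars_real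
  have h2 := (h1.of_le le_top).comp (contMDiff_polarHomeomorph φ (n := ∞))
  refine h2.congr fun x => ?_
  exact ((mappingTorusHomeomorph φ).symm_apply_apply _).symm

/-- The biholomorphism between the mapping torus and the quotient of `K × (ℂ² \ {0})`. -/
noncomputable def mappingTorusDiffeomorph :
    Diffeomorph 𝓘(ℂ, E × C2) Jc (SphereMappingTorus φ) (HopfQuotient φ) ω where
  toEquiv := (mappingTorusHomeomorph φ).toEquiv
  contMDiff_toFun := by
    refine (isLocalDiffeomorph_mappingTorusProj hφ).contMDiff_of_comp
      (surjective_mappingTorusProj φ) (contMDiff_model_prod_iff.2 ?_)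
    refine (isLocalDiffeomorph_hopfQuotient_mk hφ).contMDiff.congr fun x => ?_
    exact (mappingTorusHomeomorph φ).apply_symm_apply _
  contMDiff_invFun :=
    (isLocalDiffeomorph_hopfQuotient_mk hφ).contMDiff_of_comp Quotient.mk_surjective
      (contMDiff_model_prod_iff.1 (isLocalDiffeomorph_mappingTorusProj hφ).contMDiff)

end Quotients

/-- Bridges the product model of the final statement and `𝓘(ℝ, E × C2)`: their equality is only
propositional, so it is generalised to a variable and substituted. -/
lemma mfderiv_eq_realDeriv_of_eq {V W N M : Type*} [NormedAddCommGroup V] [NormedSpace ℝ V]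
    [NormedAddCommGroup W] [NormedSpace ℝ W] [TopologicalSpace N] [ChartedSpace V N]
    [TopologicalSpace M] [ChartedSpace W M] (f : N → M) (x : N) {J : ModelWithCorners ℝ V V}
    (hJ : J = 𝓘(ℝ, V)) :
    (show V →L[ℝ] W from mfderiv J 𝓘(ℝ, W) f x) = realDeriv V W f x := by
  subst hJ
  rfl

/-! ### Invariance of the product metric and its descent -/

section Metric

variable {E : Type*} [NormedAddCommGroup E] [NormedSpace ℂ E]
  {K : Type*} [TopologicalSpace K] [ChartedSpace E K] [IsManifold 𝓘(ℂ, E) ω K]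

/-- The product metric `g + |z|⁻² g_E` is invariant under `(p, z) ↦ (χ p, r z)` if `χ` is an
isometry. -/
lemma HermitianMetric.hopfBilin_map (g : HermitianMetric E K) {χ : K ≃ₜ K}
    (hχ : χ ∈ g.isometryGroup) {r : ℝ} (hr : r ≠ 0) {σ : K × puncturedC2 → K × puncturedC2}
    {x : K × puncturedC2} (hσ : MDifferentiableAt (realModel (E × C2)) (realModel (E × C2)) σ x)
    (h1 : ∀ y, (σ y).1 = χ y.1) (h2 : ∀ y, puncturedSnd (σ y) = r • puncturedSnd y) (v w : E × C2) :
    g.hopfBilin (σ x) (realDeriv (E × C2) (E × C2) σ x v) (realDeriv (E × C2) (E × C2) σ x w) =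
      g.hopfBilin x v w := by
  let L : C2 →L[ℝ] C2 := r • ContinuousLinearMap.id ℝ C2
  have e1 : realDeriv (E × C2) E (Prod.fst ∘ σ) x =
      (realDeriv E E χ x.1).comp (ContinuousLinearMap.fst ℝ E C2) := by
    rw [show Prod.fst ∘ σ = χ ∘ Prod.fst from funext h1,
      realDeriv_comp (hχ.1.mdifferentiableAt_real x.1) (mdifferentiableAt_fst_model x),
      realDeriv_fst]
  have e2 : realDeriv (E × C2) C2 (puncturedSnd ∘ σ) x =
      L.comp (ContinuousLinearMap.snd ℝ E C2) := by
    rw [show puncturedSnd ∘ σ = L ∘ puncturedSnd from funext h2,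
      realDeriv_comp L.mdifferentiableAt (mdifferentiableAt_puncturedSnd x),
      realDeriv_puncturedSnd, realDeriv_eq_fderiv, ContinuousLinearMap.fderiv]
  have e3 : reInner C2 (r • v.2) (r • w.2) = r ^ 2 * reInner C2 v.2 w.2 := by
    rw [map_smul, map_smul, smul_apply, smul_eq_mul, smul_eq_mul, sq, mul_assoc]
  rw [g.hopfBilin_realDeriv hσ, hopfBilin_apply, e1, e2, h1, h2]
  refine congrArg₂ (· + ·) (hχ.2.2 x.1 v.1 w.1) ?_
  change (‖r • puncturedSnd x‖ ^ 2)⁻¹ * reInner C2 (r • v.2) (r • w.2) = _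
  -- The factor `r²` from the Euclidean metric cancels the `r⁻²` from the conformal factor.
  rw [e3, norm_smul, mul_pow, Real.norm_eq_abs, sq_abs, mul_inv]
  field_simp

variable [FiniteDimensional ℂ E] [T2Space K] [LocallyCompactSpace K] {φ : K ≃ₜ K}

attribute [local instance] mappingTorusComplexCharts

/-- The product metric `g + |z|⁻² g_E` descends to the mapping torus. -/
theorem exists_metric_mappingTorus (g : HermitianMetric E K)
    (hφ : ∀ a : ℤ, φ ^ a ∈ g.isometryGroup)
    [IsManifold 𝓘(ℂ, E × C2) ω (SphereMappingTorus φ)] :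
    ∃ h : HermitianMetric (E × C2) (SphereMappingTorus φ), ∀ (x : K × puncturedC2) (v w : E × C2),
      h.bilin (mappingTorusProj φ x) (realDeriv (E × C2) (E × C2) (mappingTorusProj φ) x v)
        (realDeriv (E × C2) (E × C2) (mappingTorusProj φ) x w) = g.hopfProd.bilin x v w := by
  refine g.hopfProd.exists_descend (isLocalDiffeomorph_mappingTorusProj fun a => (hφ a).1)
    (surjective_mappingTorusProj φ) fun x x' hx => ?_
  obtain ⟨a, ha⟩ : x' ∈ AddAction.orbit ℤ (show HopfCover φ from x) :=
    Quotient.exact ((mappingTorusHomeomorph φ).symm.injective hx).symm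
  let σ : K × puncturedC2 → K × puncturedC2 := fun x => a +ᵥ (show HopfCover φ from x)
  have hσ : ContMDiff 𝓘(ℂ, E × C2) 𝓘(ℂ, E × C2) ω σ :=
    contMDiff_model_prod_iff.2 (contMDiff_prod_model_iff.2 (contMDiff_hopfCover_vadd a (hφ a).1))
  have hσ' := (hσ.restrictScalars_real x).mdifferentiableAt (by simp)
  refine ⟨σ, hσ', ha, Filter.Eventually.of_forall fun y => ?_, fun v w => ?_⟩
  · exact congrArg (mappingTorusHomeomorph φ).symm (Quotient.sound ⟨a, rfl⟩)
  · exact g.hopfBilin_map (hφ a) (zpow_ne_zero a two_ne_zero) hσ' (fun _ => rfl) (fun _ => rfl) v w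

end Metric

/-! ### The main theorem -/

theorem mainTheorem4 {E : Type*} [NormedAddCommGroup E] [NormedSpace ℂ E] [FiniteDimensional ℂ E]
    {K : Type*} [TopologicalSpace K] [T2Space K] [CompactSpace K]
    [ChartedSpace E K] [IsManifold 𝓘(ℂ, E) ω K]
    (g : HermitianMetric E K) (hg : g.IsKahler)
    (ψ : Diffeomorph 𝓘(ℂ, E) 𝓘(ℂ, E) K K ω)
    (hψ : ∀ (x : K) (v w : TangentSpace (realModel E) x),
      g.inner (ψ x) (mfderiv (realModel E) (realModel E) ψ x v)
        (mfderiv (realModel E) (realModel E) ψ x w) = g.inner x v w) :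
    -- the mapping torus is a smooth manifold, and the quotient is a complex manifold
    T2Space (SphereMappingTorus ψ.toHomeomorph) ∧
    SecondCountableTopology (SphereMappingTorus ψ.toHomeomorph) ∧
    IsManifold (((realModel E).prod (𝓡 3)).prod 𝓘(ℝ, ℝ)) ∞
      (SphereMappingTorus ψ.toHomeomorph) ∧
    IsManifold (𝓘(ℂ, E).prod 𝓘(ℂ, C2)) ω (HopfQuotient ψ.toHomeomorph) ∧
    -- the complex structure on the mapping torus, given by an atlas with values in `E × ℂ²`
    ∃ (_ : ChartedSpace (E × C2) (SphereMappingTorus ψ.toHomeomorph))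
      (_ : IsManifold 𝓘(ℂ, E × C2) ω (SphereMappingTorus ψ.toHomeomorph)),
      -- it induces the given smooth structure of the mapping torus
      ContMDiff (realModel (E × C2)) (((realModel E).prod (𝓡 3)).prod 𝓘(ℝ, ℝ)) ∞
        (id : SphereMappingTorus ψ.toHomeomorph → SphereMappingTorus ψ.toHomeomorph) ∧
      ContMDiff (((realModel E).prod (𝓡 3)).prod 𝓘(ℝ, ℝ)) (realModel (E × C2)) ∞
        (id : SphereMappingTorus ψ.toHomeomorph → SphereMappingTorus ψ.toHomeomorph) ∧
      -- the biholomorphic identification with the quotient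
      ∃ Φ : Diffeomorph 𝓘(ℂ, E × C2) (𝓘(ℂ, E).prod 𝓘(ℂ, C2))
          (SphereMappingTorus ψ.toHomeomorph) (HopfQuotient ψ.toHomeomorph) ω,
        (∀ (p : K) (q : S3) (t : ℝ),
          Φ (MappingTorus.mk _ (p, q) t) = HopfQuotient.mk _
            (p, scalePunctured ((2 : ℝ) ^ t) (by positivity) q (ne_zero_of_mem_unit_sphere q))) ∧
        -- the SKT metric, whose pull-back to `K × (ℂ² \ {0})` is the product metric
        ∃ h : HermitianMetric (E × C2) (SphereMappingTorus ψ.toHomeomorph),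
          h.IsSKT ∧
          ∀ (p : K) (z : puncturedC2) (v w : E × C2),
            h.inner (Φ.symm (HopfQuotient.mk _ (p, z)))
              (mfderiv ((realModel E).prod (realModel C2)) (realModel (E × C2))
                (fun x : K × puncturedC2 => Φ.symm (HopfQuotient.mk _ x)) (p, z) v)
              (mfderiv ((realModel E).prod (realModel C2)) (realModel (E × C2))
                (fun x : K × puncturedC2 => Φ.symm (HopfQuotient.mk _ x)) (p, z) w) =
            g.inner p v.1 w.1 + (inner ℂ v.2 w.2).re / ‖(z : C2)‖ ^ 2 := by
  have := FiniteDimensional.complexToReal E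
  have : LocallyCompactSpace K := inferInstance
  have hmem : ψ.toHomeomorph ∈ g.isometryGroup := ⟨ψ.contMDiff, ψ.symm.contMDiff, hψ⟩
  have hiso : ∀ a : ℤ, ψ.toHomeomorph ^ a ∈ g.isometryGroup := fun a => zpow_mem hmem a
  have hφ : ∀ a : ℤ, ContMDiff 𝓘(ℂ, E) 𝓘(ℂ, E) ω ⇑(ψ.toHomeomorph ^ a) := fun a => (hiso a).1
  -- Compactness and finite-dimensional charts make `K` second countable; this passes to the cover
  -- and then to its quotient.
  have hsc : SecondCountableTopology K := ChartedSpace.secondCountable_of_sigmaCompact E K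
  have hsc' : SecondCountableTopology
      (MappingTorusCover (ψ.toHomeomorph.prodCongr (Homeomorph.refl S3))) :=
    inferInstanceAs (SecondCountableTopology ((K × S3) × ℝ))
  let := mappingTorusComplexCharts (E := E) ψ.toHomeomorph
  have := isManifold_complex_sphereMappingTorus hφ
  obtain ⟨h, hh⟩ := exists_metric_mappingTorus g hiso
  have hπ := isLocalDiffeomorph_mappingTorusProj hφ
  refine ⟨inferInstance, ContinuousConstVAdd.secondCountableTopology,
    isManifold_sphereMappingTorus hφ, isManifold_hopfQuotient hφ,
    mappingTorusComplexCharts ψ.toHomeomorph, isManifold_complex_sphereMappingTorus hφ,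
    contMDiff_id_sphereMappingTorus hφ, contMDiff_id_sphereMappingTorus_symm hφ,
    mappingTorusDiffeomorph hφ, fun p q t => rfl, h,
    h.isSKT_of_pullback_eq_hopfProd hg hπ (chartsDescend_mappingTorusProj _) hh,
    fun p z v w => ?_⟩
  have key := hh (p, z) v w
  rw [g.bilin_hopfProd, g.hopfBilin_apply, mul_comm, ← div_eq_mul_inv, reInner_apply] at key
  refine Eq.trans ?_ key
  have hm := mfderiv_eq_realDeriv_of_eq (V := E × C2) (W := E × C2) (mappingTorusProj ψ.toHomeomorph) (p, z)
    (show (realModel E).prod (realModel C2) = realModel (E × C2) from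
      modelWithCornersSelf_prod.symm)
  exact congrArg₂ (fun a b => h.bilin (mappingTorusProj ψ.toHomeomorph (p, z)) a b)
    (DFunLike.congr_fun hm v) (DFunLike.congr_fun hm w)
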